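/- \textbf{Setting.} Integrals $\int_r^t$ are over $(r,t]$, and $\int_r^{t-}$ over $(r,t)$. Let $\gamma$ be an increasing càdlàg function on $[0,\infty)$ with $\gamma(0)=0$; it induces a measure $\gamma(ds)$. Let $b_1,c$ be bounded Borel functions on $[0,\infty)$ and let $m(s,dz)$ be a kernel from $[0,\infty)$ to $(0,\infty)$ such that $(1\wedge z^2)m(s,dz)$ is a bounded kernel. Put $$\phi(s,\lambda)=b_1(s)\lambda+c(s)\lambda^2+\int_0^\infty\big(e^{-\lambda z}-1+\lambda z\mathbf 1_{\{z\le 1\}}\big)\,m(s,dz),$$ and assume: (1') $c\ge 0$ and $c(s)\gamma(\{s\})=0$ for $s>0$; (2') $\big[b_1(s)+\int_0^1 z\,m(s,dz)\big]\gamma(\{s\})\le 1$ for $s>0$ (in particular the integral is finite if $\gamma(\{s\})>0$); (3') for $s>0$, if $b_1(s)\gamma(\{s\})=1$ then $m(s,(1,\infty))\gamma(\{s\})>0$. For every $k\ge 1$ let $\{g_{k,n}\}_{n\ge 0}$ be probability generating functions of distributions on $\{0,1,2,\dots\}$; put $g_{k,m,n}=g_{k,m}\circ g_{k,m+1}\circ\cdots\circ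 g_{k,n-1}$ for $n>m$ and $g_{k,m,m}(z)=z$. Let $\{\beta_k\}_{k\ge1}$ be an increasing sequence of positive constants tending to infinity, $\gamma_k(t)=\lfloor\beta_k\gamma(t)\rfloor$, $\gamma_k^{-1}(i)=\inf\{s\ge 0:\gamma_k(s)\ge i\}$, $\Delta\gamma_k(s)=\gamma_k(s)-\gamma_k(s-)$, and $J_k(r,t)=\{s\in(r,t]:\Delta\gamma_k(s)\ge 1\}$. For $s\in J_k(r,t)$ put $$I_{k,s,1}(\lambda)=k\big[g_{k,\gamma_k(s-)}(1-\lambda/k)-(1-\lambda/k)\big]-\int_{\gamma_k^{-1}(\gamma_k(s-))}^{s-}\phi(u,\lambda)\,\gamma(du),$$ $$I_{k,s,2}(\lambda)=k\big[g_{k,\gamma_k(s-)+1,\gamma_k(s)}(1-\lambda/k)-(1-\lambda/k)\big]-\phi(s,\lambda)\gamma(\{s\}),$$ and $I_{k,s}=|I_{k,s,1}|+|I_{k,s,2}|$. \textbf{Condition (A).} For every $M>0$ there are non-negative càdlàg increasing functions $F_k$ on $[0,\infty)$, $k\ge 1$, with $\lim_{k\to\infty}F_k(s)=0$ for all $s\ge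 0$, such that for each $T\ge0$ and arbitrary functions $\lambda_k:[0,T]\to[0,M\wedge k]$, $$\sum_{s\in J_k(r,t)}I_{k,s}(\lambda_k(s))\le F_k(t)-F_k(r),\qquad 0\le r\le t\le T,\ k\ge 1.$$ \textbf{Theorem.} Suppose that condition (A) holds, and let $$v_k(r,t;\lambda)=-k\log g_{k,\gamma_k(r),\gamma_k(t)}(e^{-\lambda/k}),\qquad 0\le r\le t,\ \lambda>0.$$ For all $t\ge0$ and $\lambda>0$ there is a unique bounded positive function $r\mapsto v(r,t;\lambda)$ on $[0,t]$ satisfying $$v(r,t;\lambda)=\lambda-\int_r^t\phi(s,v(s,t;\lambda))\,\gamma(ds),\qquad 0\le r\le t,$$ and for all $T\ge 0$ and $0<a<b$, $v_k(r,t;\lambda)$ converges to $v(r,t;\lambda)$ as $k\to\infty$, uniformly for $0\le r\le t\le T$ and $a\le\lambda\le b$. -/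

import Mathlib

open Set Filter Topology MeasureTheory ProbabilityTheory

namespace GWVE

noncomputable section

/-- The kernel `K₁(λ, z) = e^{-λ z} - 1 + λ z 1_{z ≤ 1}`. -/
def K1 (lam z : ℝ) : ℝ :=
  Real.exp (-lam * z) - 1 + if z ≤ 1 then lam * z else 0

/-- `φ(s, λ) = b₁(s) λ + c(s) λ² + ∫_{(0,∞)} K₁(λ, z) m(s, dz)`. -/
def phi (b c : ℝ → ℝ) (m : Kernel ℝ ℝ) (s lam : ℝ) : ℝ :=
  b s * lam + c s * lam ^ 2 + ∫ z in Ioi (0 : ℝ), K1 lam z ∂(m s)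

/-- The standing assumptions on the time scale `γ` and the coefficients `(b₁, c, m)`.
Only the values for times `s ≥ 0` and the restrictions of `m s` to `(0, ∞)` matter. -/
structure Admissible (γ : StieltjesFunction ℝ) (b c : ℝ → ℝ) (m : Kernel ℝ ℝ) : Prop where
  gamma_zero : γ 0 = 0
  measurable_b : Measurable b
  measurable_c : Measurable c
  bounded_b : ∃ C : ℝ, ∀ s, 0 ≤ s → |b s| ≤ C
  bounded_c : ∃ C : ℝ, ∀ s, 0 ≤ s → |c s| ≤ C
  /-- `(1 ∧ z²) m(s, dz)` is a bounded kernel on `(0, ∞)`. -/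
  bounded_m : ∃ C : ℝ, ∀ s, 0 ≤ s →
    ∫⁻ z in Ioi (0 : ℝ), ENNReal.ofReal (min 1 (z ^ 2)) ∂(m s) ≤ ENNReal.ofReal C
  c_nonneg : ∀ s, 0 ≤ s → 0 ≤ c s
  c_atom : ∀ s, 0 < s → c s * γ.measure.real {s} = 0
  /-- `[b₁(s) + ∫_{(0,1]} z m(s, dz)] γ({s}) ≤ 1`; at an atom of `γ` this includes the
  finiteness of the integral. -/
  atom_le : ∀ s, 0 < s → γ.measure.real {s} ≠ 0 →
    IntegrableOn (fun z : ℝ => z) (Ioc 0 1) (m s) ∧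
      (b s + ∫ z in Ioc (0 : ℝ) 1, z ∂(m s)) * γ.measure.real {s} ≤ 1
  atom_pos : ∀ s, 0 < s → b s * γ.measure.real {s} = 1 →
    0 < m s (Ioi 1) * γ.measure {s}

/-- The probability generating function of a distribution on `ℕ`. -/
def pgf (p : PMF ℕ) (z : ℝ) : ℝ := ∑' j : ℕ, (p j).toReal * z ^ j

/-- `pgfIter p m l` is the composition `g_m ∘ g_{m+1} ∘ ⋯ ∘ g_{m+l-1}`, where `g_n` is the
generating function of `p n`. -/
def pgfIter (p : ℕ → PMF ℕ) : ℕ → ℕ → ℝ → ℝ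
  | _, 0, z => z
  | m, l + 1, z => pgf (p m) (pgfIter p (m + 1) l z)

/-- `g_{m,n} = g_m ∘ ⋯ ∘ g_{n-1}` for `n ≥ m`. -/
def pgfComp (p : ℕ → PMF ℕ) (m n : ℕ) (z : ℝ) : ℝ := pgfIter p m (n - m) z

/-- `γ_k(t) = ⌊β_k γ(t)⌋`, with `β` standing for `β_k`. -/
def scale (γ : StieltjesFunction ℝ) (β : ℝ) (t : ℝ) : ℕ := ⌊β * γ t⌋₊

/-- The left limit `γ_k(s-)`. -/
def scaleLeft (γ : StieltjesFunction ℝ) (β : ℝ) (s : ℝ) : ℕ :=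
  Function.leftLim (scale γ β) s

/-- `γ_k^{-1}(i) = inf {s ≥ 0 : γ_k(s) ≥ i}`. -/
def scaleInv (γ : StieltjesFunction ℝ) (β : ℝ) (i : ℕ) : ℝ :=
  sInf {s : ℝ | 0 ≤ s ∧ i ≤ scale γ β s}

/-- `J_k(r, t) = {s ∈ (r, t] : Δγ_k(s) ≥ 1}`. -/
def jumpSet (γ : StieltjesFunction ℝ) (β : ℝ) (r t : ℝ) : Set ℝ :=
  {s | s ∈ Ioc r t ∧ scaleLeft γ β s + 1 ≤ scale γ β s}

theorem scale_mono (γ : StieltjesFunction ℝ) {β : ℝ} (hβ : 0 ≤ β) : Monotone (scale γ β) :=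
  fun _ _ h => Nat.floor_mono (mul_le_mul_of_nonneg_left (γ.mono h) hβ)

/-- The sums over `J_k(r, t)` are finite sums. -/
theorem jumpSet_finite (γ : StieltjesFunction ℝ) {β : ℝ} (hβ : 0 ≤ β) (r t : ℝ) :
    (jumpSet γ β r t).Finite := by
  have hmono := scale_mono γ hβ
  refine Set.Finite.of_finite_image (f := scale γ β)
    ((Set.finite_Iic (scale γ β t)).subset ?_) ?_
  · rintro _ ⟨s, hs, rfl⟩
    exact hmono hs.1.2
  · have key : StrictMonoOn (scale γ β) (jumpSet γ β r t) := by
      intro x _ y hy hxy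
      have h1 : scale γ β x ≤ scaleLeft γ β y := hmono.le_leftLim hxy
      have h2 := hy.2
      omega
    exact key.injOn

/-- `I_{k,s,1}(λ)`, with `p n` the law whose generating function is `g_{k,n}`. -/
def I1 (γ : StieltjesFunction ℝ) (b c : ℝ → ℝ) (m : Kernel ℝ ℝ) (β : ℝ) (p : ℕ → PMF ℕ)
    (k : ℕ) (s lam : ℝ) : ℝ :=
  k * (pgf (p (scaleLeft γ β s)) (1 - lam / k) - (1 - lam / k))
    - ∫ u in Ioo (scaleInv γ β (scaleLeft γ β s)) s, phi b c m u lam ∂γ.measure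

/-- `I_{k,s,2}(λ)`. -/
def I2 (γ : StieltjesFunction ℝ) (b c : ℝ → ℝ) (m : Kernel ℝ ℝ) (β : ℝ) (p : ℕ → PMF ℕ)
    (k : ℕ) (s lam : ℝ) : ℝ :=
  k * (pgfComp p (scaleLeft γ β s + 1) (scale γ β s) (1 - lam / k) - (1 - lam / k))
    - phi b c m s lam * γ.measure.real {s}

/-- Condition (A). The functions `F_k` are nonnegative, increasing and càdlàg on `[0, ∞)`; the
test functions are arbitrary functions with values in `[0, M]` for which the argument
`1 - λ_k(s)/k` of the generating functions lies in `[0, 1]`. -/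
def ConditionA (γ : StieltjesFunction ℝ) (b c : ℝ → ℝ) (m : Kernel ℝ ℝ)
    (β : ℕ → ℝ) (p : ℕ → ℕ → PMF ℕ) : Prop :=
  ∀ M : ℝ, 0 < M → ∃ F : ℕ → StieltjesFunction ℝ,
    (∀ k, 1 ≤ k → ∀ s, 0 ≤ s → 0 ≤ F k s) ∧
    (∀ s, 0 ≤ s → Tendsto (fun k => F k s) atTop (𝓝 0)) ∧
    ∀ T : ℝ, 0 ≤ T → ∀ lam : ℕ → ℝ → ℝ,
      (∀ k : ℕ, 1 ≤ k → ∀ s ∈ Icc 0 T, lam k s ∈ Icc 0 (min M (k : ℝ))) →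
      ∀ k : ℕ, 1 ≤ k → ∀ r t : ℝ, 0 ≤ r → r ≤ t → t ≤ T →
        ∑ᶠ s ∈ jumpSet γ (β k) r t,
          (|I1 γ b c m (β k) (p k) k s (lam k s)| + |I2 γ b c m (β k) (p k) k s (lam k s)|)
          ≤ F k t - F k r

/-- The discrete cumulant semigroup
`v_k(r, t; λ) = -k log g_{k,γ_k(r),γ_k(t)}(e^{-λ/k})`. -/
def vk (γ : StieltjesFunction ℝ) (β : ℕ → ℝ) (p : ℕ → ℕ → PMF ℕ) (k : ℕ) (r t lam : ℝ) : ℝ :=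
  -(k : ℝ) * Real.log
    (pgfComp (p k) (scale γ (β k) r) (scale γ (β k) t) (Real.exp (-lam / k)))

/-- `w` is a bounded positive solution on `[0, t]` of
`w(r) = λ - ∫_{(r,t]} φ(s, w(s)) γ(ds)`. -/
def IsSolution (γ : StieltjesFunction ℝ) (b c : ℝ → ℝ) (m : Kernel ℝ ℝ) (t lam : ℝ)
    (w : ℝ → ℝ) : Prop :=
  (∀ r ∈ Icc 0 t, 0 < w r) ∧
  (∃ B : ℝ, ∀ r ∈ Icc 0 t, w r ≤ B) ∧
  IntegrableOn (fun s => phi b c m s (w s)) (Ioc 0 t) γ.measure ∧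
  ∀ r ∈ Icc 0 t, w r = lam - ∫ s in Ioc r t, phi b c m s (w s) ∂γ.measure

end

end GWVE

/-!
Write `u_k(r) = k (1 - g_{k,γ_k(r),γ_k(t)}(e^{-λ/k}))`, which differs from `v_k(r,t;λ)` by `O(1/k)`
as long as it stays bounded. Across a jump of `γ_k` the function `u_k` satisfies, up to the errors
`I_{k,s,1}` and `I_{k,s,2}`, the integral equation for `v` with the argument of `φ` frozen on the
preceding block of constancy of `γ_k`. A block carries `γ`-mass at most `1/β_k`, so freezing costs
`O(1/β_k)`, and condition (A) makes the errors sum to `O(F_k(T))`. Hence `u_k` is close to `v` by a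
discrete Gronwall recursion running backwards over the jumps (`abs_cumulant_sub_le`).

The difficulty is that `φ(s, ·)` is Lipschitz only on intervals `[ε, M]` with `ε > 0`: near `0` its
slope may be infinite. One therefore needs bounds `ε ≤ v ≤ M` that are uniform over the horizons
`t ≤ T` and the terminal values `λ ∈ [a, b]` (`Admissible.exists_bounds`).

* The upper bound is Gronwall's inequality, from `-φ(s, x) ≤ B (x + 1)`.
* The lower bound uses that `φ(s, ·)` is convex with `φ(s, 0) = 0`, so `φ(s, x) ≤ (x / M) φ(s, M)`
  on `[0, M]`. On a stretch of small `γ`-mass, `v` then loses at most a fixed fraction of its value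
  (`IsBackwardIntegral.le_of_le_of_mass_le`), and at an atom it is multiplied by at least
  `1 - φ(s, M) γ({s}) / M`, which is positive by the conditions on the atoms
  (`Admissible.sub_phi_mul_atom_pos`). Only finitely many blocks and large atoms occur.

Existence follows by Picard iteration for the equation in which the argument of `φ` is truncated to
`[ε, M]`, since the bounds show that the truncation is not active; uniqueness is Gronwall's
inequality on `[ε, M]`. Both rest on `∫_{(r,t]} e^{K(γ(t)-γ(s))} γ(ds) ≤ e^{K(γ(t)-γ(r))} / K`
(`integral_exp_le`), which holds in the presence of atoms because the integrand is evaluated at the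
later end of each jump.
-/

namespace GWVE

/-! ### Integrals against a Stieltjes measure -/

/-- Right continuity of `γ`, in order form. -/
theorem le_apply_of_forall_gt (γ : StieltjesFunction ℝ) {x a : ℝ} (h : ∀ y, a < y → x ≤ γ y) :
    x ≤ γ a := by
  rw [← γ.iInf_Ioi_eq a]
  exact le_ciInf fun y => h y y.2

theorem measureReal_Ioc (γ : StieltjesFunction ℝ) {r t : ℝ} (h : r ≤ t) :
    γ.measure.real (Ioc r t) = γ t - γ r := by
  rw [Measure.real, γ.measure_Ioc, ENNReal.toReal_ofReal (sub_nonneg.2 (γ.mono h))]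

theorem measure_Ioc_ne_top (γ : StieltjesFunction ℝ) (r t : ℝ) : γ.measure (Ioc r t) ≠ ⊤ := by
  rw [γ.measure_Ioc]; exact ENNReal.ofReal_ne_top

/-- The generalized inverse of `γ` is adjoint to `γ`. -/
theorem sInf_le_iff_le (γ : StieltjesFunction ℝ) {r t x a : ℝ} (hx : x ∈ Ioc (γ r) (γ t)) :
    sInf {s | x ≤ γ s} ≤ a ↔ x ≤ γ a := by
  have hbdd : BddBelow {s | x ≤ γ s} :=
    ⟨r, fun s hs => le_of_not_gt fun h => absurd (hx.1.trans_le hs) (not_lt.2 (γ.mono h.le))⟩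
  refine ⟨fun h => ?_, fun h => csInf_le hbdd h⟩
  refine le_apply_of_forall_gt γ fun y hy => ?_
  obtain ⟨s, hs, hsy⟩ := exists_lt_of_csInf_lt ⟨t, hx.2⟩ (h.trans_lt hy)
  exact le_trans hs (γ.mono hsy.le)

theorem monotoneOn_quantile (γ : StieltjesFunction ℝ) (r t : ℝ) :
    MonotoneOn (fun x => sInf {s | x ≤ γ s}) (Ioc (γ r) (γ t)) := by
  intro x hx y hy hxy
  exact (sInf_le_iff_le γ hx).2 (hxy.trans ((sInf_le_iff_le γ hy).1 le_rfl))

/-- The generalized inverse of `γ` carries Lebesgue measure on `(γ r, γ t]` to the Stieltjes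
measure of `γ` on `(r, t]`. -/
theorem map_quantile (γ : StieltjesFunction ℝ) (r t : ℝ) :
    Measure.map (fun x => sInf {s | x ≤ γ s}) (volume.restrict (Ioc (γ r) (γ t))) =
      γ.measure.restrict (Ioc r t) := by
  have hq : AEMeasurable (fun x => sInf {s | x ≤ γ s}) (volume.restrict (Ioc (γ r) (γ t))) :=
    aemeasurable_restrict_of_monotoneOn measurableSet_Ioc (monotoneOn_quantile γ r t)
  have : IsFiniteMeasure (Measure.map (fun x => sInf {s | x ≤ γ s})
      (volume.restrict (Ioc (γ r) (γ t)))) := by infer_instance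
  refine Measure.ext_of_Iic _ _ fun a => ?_
  rw [Measure.map_apply_of_aemeasurable hq measurableSet_Iic,
    Measure.restrict_apply' measurableSet_Ioc, Measure.restrict_apply measurableSet_Iic]
  have h1 : (fun x => sInf {s | x ≤ γ s}) ⁻¹' Iic a ∩ Ioc (γ r) (γ t) =
      Ioc (γ r) (γ (min a t)) := by
    ext x
    simp only [mem_inter_iff, mem_preimage, mem_Iic, mem_Ioc, γ.mono.map_min, le_min_iff]
    constructor
    · rintro ⟨h, hx⟩
      exact ⟨hx.1, (sInf_le_iff_le γ hx).1 h, hx.2⟩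
    · rintro ⟨h, h', h''⟩
      exact ⟨(sInf_le_iff_le γ ⟨h, h''⟩).2 h', h, h''⟩
  have h2 : Iic a ∩ Ioc r t = Ioc r (min a t) := by
    ext x; simp only [mem_inter_iff, mem_Iic, mem_Ioc, le_min_iff]; tauto
  rw [h1, h2, γ.measure_Ioc, Real.volume_Ioc]

/-- The exponential weight `e^{K(γ(t) - γ(s))}` behaves under backward Stieltjes integration at
least as well as for `γ(s) = s`: jumps of `γ` only help, because the weight is evaluated at the
right end of each jump. -/
theorem integral_exp_le (γ : StieltjesFunction ℝ) {K : ℝ} (hK : 0 < K) {r t : ℝ} (hrt : r ≤ t) :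
    ∫ s in Ioc r t, Real.exp (K * (γ t - γ s)) ∂γ.measure ≤
      Real.exp (K * (γ t - γ r)) / K := by
  have hq : AEMeasurable (fun x => sInf {s | x ≤ γ s}) (volume.restrict (Ioc (γ r) (γ t))) :=
    aemeasurable_restrict_of_monotoneOn measurableSet_Ioc (monotoneOn_quantile γ r t)
  have hm : Measurable fun s => Real.exp (K * (γ t - γ s)) :=
    ((γ.mono.measurable.const_sub _).const_mul _).exp
  rw [← map_quantile, integral_map hq hm.aestronglyMeasurable]
  have hint : IntegrableOn (fun x => Real.exp (K * (γ t - x))) (Ioc (γ r) (γ t)) :=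
    (Continuous.integrableOn_Icc (by fun_prop)).mono_set Ioc_subset_Icc_self
  have hle : ∀ x ∈ Ioc (γ r) (γ t),
      Real.exp (K * (γ t - γ (sInf {s | x ≤ γ s}))) ≤ Real.exp (K * (γ t - x)) := by
    intro x hx
    have := (sInf_le_iff_le γ hx).1 le_rfl
    gcongr
  have hint' : IntegrableOn (fun x => Real.exp (K * (γ t - γ (sInf {s | x ≤ γ s}))))
      (Ioc (γ r) (γ t)) := by
    refine Integrable.mono' hint (hm.comp_aemeasurable hq).aestronglyMeasurable ?_
    refine (ae_restrict_iff' measurableSet_Ioc).2 (ae_of_all _ fun x hx => ?_)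
    rw [Real.norm_of_nonneg (Real.exp_pos _).le]
    exact hle x hx
  refine (setIntegral_mono_on hint' hint measurableSet_Ioc hle).trans ?_
  rw [← intervalIntegral.integral_of_le (γ.mono hrt)]
  have hderiv : ∀ x ∈ uIcc (γ r) (γ t),
      HasDerivAt (fun x => -Real.exp (K * (γ t - x)) / K) (Real.exp (K * (γ t - x))) x := by
    intro x _
    have h1 : HasDerivAt (fun x => K * (γ t - x)) (K * (0 - 1)) x :=
      ((hasDerivAt_const x (γ t)).sub (hasDerivAt_id x)).const_mul K
    have h2 := (h1.exp.neg).div_const K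
    refine h2.congr_deriv ?_
    field_simp
    ring
  rw [intervalIntegral.integral_eq_sub_of_hasDerivAt hderiv
    (Continuous.intervalIntegrable (by fun_prop) _ _)]
  have : 0 < Real.exp (K * (γ t - γ t)) / K := by positivity
  rw [neg_div, neg_div]
  linarith

theorem integrableOn_of_bounded (γ : StieltjesFunction ℝ) {r t C : ℝ} {f : ℝ → ℝ}
    (hf : AEStronglyMeasurable f (γ.measure.restrict (Ioc r t)))
    (hC : ∀ s ∈ Ioc r t, |f s| ≤ C) : IntegrableOn f (Ioc r t) γ.measure :=
  Integrable.mono' (integrableOn_const (C := C) (measure_Ioc_ne_top γ r t)) hf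
    ((ae_restrict_iff' measurableSet_Ioc).2 (ae_of_all _ hC))

theorem integrableOn_exp (γ : StieltjesFunction ℝ) {K : ℝ} (hK : 0 ≤ K) (r t T : ℝ) :
    IntegrableOn (fun s => Real.exp (K * (γ T - γ s))) (Ioc r t) γ.measure := by
  have hm : Measurable fun s => Real.exp (K * (γ T - γ s)) :=
    ((γ.mono.measurable.const_sub _).const_mul _).exp
  refine integrableOn_of_bounded γ hm.aestronglyMeasurable (C := Real.exp (K * (γ T - γ r)))
    fun s hs => ?_
  rw [abs_of_pos (Real.exp_pos _)]
  have := γ.mono hs.1.le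
  gcongr

theorem abs_setIntegral_Ioc_le (γ : StieltjesFunction ℝ) {r t C : ℝ} {f : ℝ → ℝ} (hrt : r ≤ t)
    (hC : ∀ s ∈ Ioc r t, |f s| ≤ C) :
    |∫ s in Ioc r t, f s ∂γ.measure| ≤ C * (γ t - γ r) := by
  have := norm_setIntegral_le_of_norm_le_const (measure_Ioc_ne_top γ r t).lt_top (f := f)
    (C := C) hC
  rwa [measureReal_Ioc γ hrt] at this

/-- Backward Gronwall inequality for a Stieltjes measure, atoms included. -/
theorem gronwall (γ : StieltjesFunction ℝ) {y : ℝ → ℝ} {A B D t : ℝ} (hB : 0 < B)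
    (hA : 0 ≤ A) (hm : AEStronglyMeasurable y (γ.measure.restrict (Ioc 0 t)))
    (hbd : ∀ r ∈ Icc 0 t, |y r| ≤ D)
    (hy : ∀ r ∈ Icc 0 t, y r ≤ A + B * ∫ s in Ioc r t, y s ∂γ.measure) :
    ∀ r ∈ Icc 0 t, y r ≤ 2 * A * Real.exp (2 * B * (γ t - γ r)) := by
  intro r₀ hr₀
  set E : ℝ → ℝ := fun s => Real.exp (2 * B * (γ t - γ s)) with hE
  have hE1 : ∀ s ∈ Icc 0 t, 1 ≤ E s := fun s hs =>
    Real.one_le_exp (by have := γ.mono hs.2; have : 0 ≤ γ t - γ s := by linarith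
                        positivity)
  have hEpos : ∀ s, 0 < E s := fun s => Real.exp_pos _
  set S : Set ℝ := (fun s => y s / E s) '' Icc 0 t with hS
  have hSb : BddAbove S := by
    refine ⟨D, ?_⟩
    rintro _ ⟨s, hs, rfl⟩
    have h1 := hbd s hs
    have h2 : 0 ≤ D := (abs_nonneg _).trans h1
    change y s / E s ≤ D
    rw [div_le_iff₀ (hEpos s)]
    nlinarith [le_abs_self (y s), hE1 s hs]
  have hle : ∀ s ∈ Icc 0 t, y s ≤ sSup S * E s := fun s hs => by
    rw [← div_le_iff₀ (hEpos s)]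
    exact le_csSup hSb ⟨s, hs, rfl⟩
  have key : ∀ r ∈ Icc 0 t, y r / E r ≤ A + (sSup S ⊔ 0) / 2 := by
    intro r hr
    rw [div_le_iff₀ (hEpos r)]
    have hsub : Ioc r t ⊆ Ioc 0 t := Ioc_subset_Ioc_left hr.1
    have h1 : ∫ s in Ioc r t, y s ∂γ.measure ≤ ∫ s in Ioc r t, (sSup S ⊔ 0) * E s ∂γ.measure := by
      refine setIntegral_mono_on ?_ ?_ measurableSet_Ioc fun s hs => ?_
      · exact integrableOn_of_bounded γ (hm.mono_measure (Measure.restrict_mono hsub le_rfl))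
          (C := D) fun s hs => hbd s ⟨(hsub hs).1.le, hs.2⟩
      · exact (integrableOn_exp γ (by positivity) r t t).const_mul _
      · exact (hle s ⟨(hsub hs).1.le, hs.2⟩).trans
          (mul_le_mul_of_nonneg_right le_sup_left (hEpos s).le)
    rw [integral_const_mul] at h1
    have h2 := integral_exp_le γ (K := 2 * B) (by positivity) hr.2
    have h3 : (sSup S ⊔ 0) * ∫ s in Ioc r t, E s ∂γ.measure ≤ (sSup S ⊔ 0) * (E r / (2 * B)) :=
      mul_le_mul_of_nonneg_left h2 le_sup_right
    calc y r ≤ A + B * ∫ s in Ioc r t, y s ∂γ.measure := hy r hr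
      _ ≤ A * E r + B * ((sSup S ⊔ 0) * (E r / (2 * B))) := by
        have := mul_le_mul_of_nonneg_left (h1.trans h3) hB.le
        nlinarith [hE1 r hr]
      _ = _ := by field_simp
  have hsup : sSup S ≤ A + (sSup S ⊔ 0) / 2 := by
    refine csSup_le ⟨_, r₀, hr₀, rfl⟩ ?_
    rintro _ ⟨r, hr, rfl⟩
    exact key r hr
  have h2A : sSup S ≤ 2 * A := by
    rcases le_total (sSup S) 0 with h | h
    · linarith
    · rw [sup_eq_left.2 h] at hsup; linarith
  exact (hle r₀ hr₀).trans (mul_le_mul_of_nonneg_right h2A (hEpos r₀).le)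

/-- Picard iteration for the backward Stieltjes equation with a bounded Lipschitz integrand. In the
norm weighted by `e^{2L(γ(t) - γ(r))}` the iteration contracts by the factor `1/2`. -/
theorem exists_picard (γ : StieltjesFunction ℝ) {F : ℝ → ℝ → ℝ} {C L : ℝ} (hL : 0 < L)
    (hF : Measurable (Function.uncurry F)) (hC : ∀ s x, |F s x| ≤ C)
    (hLip : ∀ s x y, |F s x - F s y| ≤ L * |x - y|) (t lam : ℝ) :
    ∃ w : ℝ → ℝ, Measurable w ∧
      ∀ r ≤ t, w r = lam - ∫ s in Ioc r t, F s (w s) ∂γ.measure := by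
  set Φ : (ℝ → ℝ) → ℝ → ℝ := fun w r => lam - ∫ s in Ioc r t, F s (w s) ∂γ.measure with hΦ
  set W : ℕ → ℝ → ℝ := fun n => Φ^[n] fun _ => lam with hW
  have hWs : ∀ n, W (n + 1) = Φ (W n) := fun n => Function.iterate_succ_apply' _ _ _
  have hcomp : ∀ w : ℝ → ℝ, Measurable w → Measurable fun s => F s (w s) := fun w hw =>
    hF.comp (measurable_id.prodMk hw)
  have hintF : ∀ w : ℝ → ℝ, Measurable w → ∀ r, IntegrableOn (fun s => F s (w s)) (Ioc r t)
      γ.measure := fun w hw r =>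
    integrableOn_of_bounded γ (hcomp w hw).aestronglyMeasurable fun s _ => hC s _
  -- The integral over `(r, t]` is measurable in `r`, as a difference of two monotone functions.
  have hΦm : ∀ w : ℝ → ℝ, Measurable w → Measurable (Φ w) := by
    intro w hw
    have hanti : ∀ g : ℝ → ℝ, (∀ s, 0 ≤ g s) → (∀ r, IntegrableOn g (Ioc r t) γ.measure) →
        Measurable fun r => ∫ s in Ioc r t, g s ∂γ.measure := by
      intro g hg hgi
      refine Antitone.measurable fun r r' hr => ?_
      exact setIntegral_mono_set (hgi r) (ae_of_all _ hg)
        (Ioc_subset_Ioc_left hr).eventuallyLE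
    have h1 := hanti (fun s => F s (w s) + C)
      (fun s => by linarith [neg_abs_le (F s (w s)), hC s (w s)])
      fun r => (hintF w hw r).add (integrableOn_const (measure_Ioc_ne_top γ r t))
    have h2 := hanti (fun _ => C) (fun s => (abs_nonneg _).trans (hC s 0))
      fun r => integrableOn_const (measure_Ioc_ne_top γ r t)
    have : Φ w = fun r => lam - (∫ s in Ioc r t, (F s (w s) + C) ∂γ.measure -
        ∫ s in Ioc r t, C ∂γ.measure) := by
      funext r
      rw [integral_add (hintF w hw r) (integrableOn_const (measure_Ioc_ne_top γ r t))]
      simp [hΦ]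
    rw [this]
    exact (h1.sub h2).const_sub _
  have hWm : ∀ n, Measurable (W n) := by
    intro n
    induction n with
    | zero => exact measurable_const
    | succ n ih => rw [hWs]; exact hΦm _ ih
  set E : ℝ → ℝ := fun s => Real.exp (2 * L * (γ t - γ s)) with hE
  set D : ℝ := C / (2 * L) with hD
  have hC0 : 0 ≤ C := (abs_nonneg _).trans (hC 0 0)
  have hdiff : ∀ n r, r ≤ t → |W n r - W (n + 1) r| ≤ D * E r * (1 / 2) ^ n := by
    intro n
    induction n with
    | zero =>
      intro r hr
      have h0 : W 0 r - W (0 + 1) r = ∫ s in Ioc r t, F s (W 0 s) ∂γ.measure := by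
        rw [hWs]; simp [hΦ, hW]
      rw [h0]
      refine (abs_setIntegral_Ioc_le γ hr fun s _ => hC s _).trans ?_
      have h1 := Real.add_one_le_exp (2 * L * (γ t - γ r))
      have h2 : C * (γ t - γ r) = D * (2 * L * (γ t - γ r)) := by rw [hD]; field_simp
      rw [h2, pow_zero, mul_one]
      exact mul_le_mul_of_nonneg_left (by simp only [hE]; linarith) (by positivity)
    | succ n ih =>
      intro r hr
      have h0 : W (n + 1) r - W (n + 1 + 1) r =
          -∫ s in Ioc r t, (F s (W n s) - F s (W (n + 1) s)) ∂γ.measure := by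
        rw [integral_sub (hintF _ (hWm n) r) (hintF _ (hWm (n + 1)) r), hWs (n + 1), hWs n]
        simp only [hΦ]; ring
      have hEi := integrableOn_exp γ (K := 2 * L) (by positivity) r t t
      rw [h0, abs_neg]
      calc |∫ s in Ioc r t, (F s (W n s) - F s (W (n + 1) s)) ∂γ.measure|
          ≤ ∫ s in Ioc r t, |F s (W n s) - F s (W (n + 1) s)| ∂γ.measure :=
            abs_integral_le_integral_abs
        _ ≤ ∫ s in Ioc r t, L * (D * (1 / 2) ^ n) * E s ∂γ.measure := by
            refine setIntegral_mono_on ?_ (hEi.const_mul _) measurableSet_Ioc fun s hs => ?_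
            · exact ((hintF _ (hWm n) r).sub (hintF _ (hWm (n + 1)) r)).abs
            · refine (hLip s _ _).trans ?_
              calc L * |W n s - W (n + 1) s| ≤ L * (D * E s * (1 / 2) ^ n) :=
                    mul_le_mul_of_nonneg_left (ih s hs.2) hL.le
                _ = _ := by ring
        _ = L * (D * (1 / 2) ^ n) * ∫ s in Ioc r t, E s ∂γ.measure := integral_const_mul _ _
        _ ≤ L * (D * (1 / 2) ^ n) * (E r / (2 * L)) :=
            mul_le_mul_of_nonneg_left (integral_exp_le γ (by positivity) hr) (by positivity)
        _ = D * E r * (1 / 2) ^ (n + 1) := by field_simp; ring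
  have hW_gt : ∀ n r, t < r → W n r = lam := by
    intro n r hr
    cases n with
    | zero => rfl
    | succ n => rw [hWs]; simp [hΦ, Ioc_eq_empty (not_lt.2 hr.le)]
  have hlim : ∀ r, ∃ x, Tendsto (fun n => W n r) atTop (𝓝 x) := by
    intro r
    rcases le_or_gt r t with hr | hr
    · refine cauchySeq_tendsto_of_complete (cauchySeq_of_le_geometric (1 / 2) (D * E r)
        (by norm_num) fun n => ?_)
      rw [Real.dist_eq]; exact hdiff n r hr
    · exact ⟨lam, by simp only [hW_gt _ r hr]; exact tendsto_const_nhds⟩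
  choose w hw using hlim
  have hwm : Measurable w := measurable_of_tendsto_metrizable hWm (tendsto_pi_nhds.2 hw)
  refine ⟨w, hwm, fun r hr => ?_⟩
  have h1 : Tendsto (fun n => W (n + 1) r) atTop (𝓝 (w r)) := (tendsto_add_atTop_iff_nat 1).2 (hw r)
  have h2 : Tendsto (fun n => W (n + 1) r) atTop
      (𝓝 (lam - ∫ s in Ioc r t, F s (w s) ∂γ.measure)) := by
    simp only [hWs]
    refine tendsto_const_nhds.sub ?_
    refine tendsto_integral_of_dominated_convergence (fun _ => C)
      (fun n => (hcomp _ (hWm n)).aestronglyMeasurable)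
      (integrableOn_const (measure_Ioc_ne_top γ r t)) (fun n => ae_of_all _ fun s => hC s _)
      (ae_of_all _ fun s => ?_)
    have h3 : Tendsto (fun n => L * |W n s - w s|) atTop (𝓝 0) := by
      have := ((hw s).sub_const (w s)).abs.const_mul L
      simpa using this
    rw [tendsto_iff_dist_tendsto_zero]
    exact squeeze_zero (fun _ => dist_nonneg) (fun n => hLip s _ _) h3
  exact tendsto_nhds_unique h1 h2

/-! ### The branching mechanism -/

theorem exp_neg_sub_one_add_nonneg (u : ℝ) : 0 ≤ Real.exp (-u) - 1 + u := by
  linarith [Real.add_one_le_exp (-u)]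

theorem exp_neg_sub_one_add_le_sq {u : ℝ} (hu : 0 ≤ u) : Real.exp (-u) - 1 + u ≤ u ^ 2 := by
  have h1 : Real.exp (-u) * (u + 1) ≤ 1 := by
    calc Real.exp (-u) * (u + 1) ≤ Real.exp (-u) * Real.exp u :=
          mul_le_mul_of_nonneg_left (Real.add_one_le_exp u) (Real.exp_pos _).le
      _ = 1 := by rw [← Real.exp_add]; simp
  nlinarith [exp_neg_sub_one_add_nonneg u]

theorem min_one_sq_of_le {z : ℝ} (h0 : 0 < z) (h : z ≤ 1) : min 1 (z ^ 2) = z ^ 2 :=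
  min_eq_right (by nlinarith)

theorem min_one_sq_of_lt {z : ℝ} (h : 1 < z) : min 1 (z ^ 2) = 1 :=
  min_eq_left (by nlinarith)

theorem measurable_K1 (x : ℝ) : Measurable (K1 x) := by
  unfold K1
  refine ((measurable_id.const_mul _).exp.sub_const _).add ?_
  exact Measurable.ite measurableSet_Iic (measurable_id.const_mul _) measurable_const

theorem neg_min_le_K1 {x z : ℝ} (hz : 0 < z) : -min 1 (z ^ 2) ≤ K1 x z := by
  unfold K1
  split_ifs with h
  · have := exp_neg_sub_one_add_nonneg (x * z)
    rw [min_one_sq_of_le hz h]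
    rw [neg_mul]
    nlinarith [sq_nonneg z]
  · rw [min_one_sq_of_lt (not_le.1 h)]
    linarith [Real.exp_pos (-x * z)]

theorem abs_K1_le {x z M : ℝ} (hx : 0 ≤ x) (hxM : x ≤ M) (hz : 0 < z) :
    |K1 x z| ≤ (1 + M ^ 2) * min 1 (z ^ 2) := by
  have hmin : 0 ≤ min 1 (z ^ 2) := by positivity
  rw [abs_le]
  constructor
  · have := neg_min_le_K1 (x := x) hz
    nlinarith [mul_nonneg (sq_nonneg M) hmin]
  · unfold K1
    split_ifs with h
    · rw [min_one_sq_of_le hz h, neg_mul]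
      have h1 := exp_neg_sub_one_add_le_sq (mul_nonneg hx hz.le)
      have h2 : (x * z) ^ 2 ≤ M ^ 2 * z ^ 2 := by rw [mul_pow]; gcongr
      nlinarith [sq_nonneg z]
    · rw [min_one_sq_of_lt (not_le.1 h)]
      have : Real.exp (-x * z) ≤ 1 := Real.exp_le_one_iff.2 (by nlinarith)
      nlinarith [sq_nonneg M]

theorem abs_K1_sub_le {x y z ε M : ℝ} (hε : 0 < ε) (hx : x ∈ Icc ε M) (hy : y ∈ Icc ε M)
    (hz : 0 < z) : |K1 x z - K1 y z| ≤ (M + 1 / ε) * |x - y| * min 1 (z ^ 2) := by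
  wlog hxy : x ≤ y generalizing x y with H
  · rw [abs_sub_comm, abs_sub_comm x]
    exact H hy hx (le_of_not_ge hxy)
  have hx0 : 0 < x := hε.trans_le hx.1
  set d := y - x with hd
  have hd0 : 0 ≤ d := sub_nonneg.2 hxy
  have hdz : 0 ≤ d * z := mul_nonneg hd0 hz.le
  have hM : 0 < M := hx0.trans_le hx.2
  have e1 : Real.exp (-y * z) = Real.exp (-x * z) * Real.exp (-(d * z)) := by
    rw [← Real.exp_add]; congr 1; rw [hd]; ring
  have e2 : Real.exp (-x * z) = Real.exp (-y * z) * Real.exp (d * z) := by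
    rw [← Real.exp_add]; congr 1; rw [hd]; ring
  have hx1 : Real.exp (-x * z) ≤ 1 := Real.exp_le_one_iff.2 (by nlinarith)
  have p1 := Real.exp_pos (-x * z)
  have p2 := Real.exp_pos (-y * z)
  have b1 := Real.add_one_le_exp (-(d * z))
  have b2 := Real.add_one_le_exp (d * z)
  have hle : Real.exp (-y * z) ≤ Real.exp (-x * z) := Real.exp_le_exp.2 (by nlinarith)
  have hup : Real.exp (-x * z) - Real.exp (-y * z) ≤ Real.exp (-x * z) * (d * z) := by
    rw [e1]; nlinarith
  rw [abs_sub_comm, abs_sub_comm x, abs_of_nonneg hd0]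
  unfold K1
  split_ifs with h
  · rw [min_one_sq_of_le hz h]
    have b3 : 1 - Real.exp (-y * z) ≤ y * z := by linarith [Real.add_one_le_exp (-y * z)]
    have hlow : Real.exp (-y * z) * (d * z) ≤ Real.exp (-x * z) - Real.exp (-y * z) := by
      rw [e2]; nlinarith
    rw [abs_le]
    have hnn : 0 ≤ (M + 1 / ε) * d * z ^ 2 := by positivity
    constructor
    · nlinarith
    · have h3 : (d * z) * (1 - Real.exp (-y * z)) ≤ (d * z) * (y * z) :=
        mul_le_mul_of_nonneg_left b3 hdz
      have h4 : (d * z) * (y * z) ≤ (M + 1 / ε) * d * z ^ 2 := by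
        have : y ≤ M + 1 / ε := hy.2.trans (by linarith [one_div_pos.2 hε])
        calc (d * z) * (y * z) = y * (d * z ^ 2) := by ring
          _ ≤ (M + 1 / ε) * (d * z ^ 2) := mul_le_mul_of_nonneg_right this (by positivity)
          _ = _ := by ring
      have h5 : y * z - x * z = d * z := by rw [hd]; ring
      nlinarith
  · rw [min_one_sq_of_lt (not_le.1 h), abs_le]
    have h6 : Real.exp (-x * z) * z ≤ 1 / ε := by
      rw [le_div_iff₀ hε]
      have h7 := Real.add_one_le_exp (x * z)
      have h8 : Real.exp (-x * z) * Real.exp (x * z) = 1 := by rw [← Real.exp_add]; simp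
      have h9 : ε * z ≤ x * z := mul_le_mul_of_nonneg_right hx.1 hz.le
      nlinarith
    have h10 : Real.exp (-x * z) * (d * z) ≤ (M + 1 / ε) * d := by nlinarith
    constructor <;> nlinarith [mul_nonneg (by positivity : 0 ≤ M + 1 / ε) hd0]

theorem K1_le_div_mul {x z M : ℝ} (hM : 0 < M) (hx : 0 ≤ x) (hxM : x ≤ M) :
    K1 x z ≤ x / M * K1 M z := by
  have hq0 : 0 ≤ x / M := div_nonneg hx hM.le
  have hq1 : x / M ≤ 1 := (div_le_one hM).2 hxM
  have hxe : x = x / M * M := by field_simp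
  have hconv := convexOn_exp.2 (mem_univ (-M * z)) (mem_univ 0) hq0 (sub_nonneg.2 hq1) (by ring)
  simp only [smul_eq_mul, mul_zero, add_zero, Real.exp_zero, mul_one] at hconv
  have e : -x * z = x / M * (-M * z) := by field_simp
  unfold K1
  rw [e]
  split_ifs
  · have e' : x * z = x / M * (M * z) := by field_simp
    rw [e']; linarith
  · linarith

namespace Admissible

variable {γ : StieltjesFunction ℝ} {b c : ℝ → ℝ} {m : Kernel ℝ ℝ}

theorem integrableOn_min (h : Admissible γ b c m) {s : ℝ} (hs : 0 ≤ s) :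
    IntegrableOn (fun z : ℝ => min 1 (z ^ 2)) (Ioi 0) (m s) := by
  obtain ⟨C, hC⟩ := h.bounded_m
  refine ⟨by fun_prop, ?_⟩
  rw [hasFiniteIntegral_iff_ofReal (ae_of_all _ fun z => by positivity)]
  exact (hC s hs).trans_lt ENNReal.ofReal_lt_top

theorem exists_integral_min_le (h : Admissible γ b c m) :
    ∃ C : ℝ, 0 ≤ C ∧ ∀ s, 0 ≤ s → ∫ z in Ioi (0 : ℝ), min 1 (z ^ 2) ∂(m s) ≤ C := by
  obtain ⟨C, hC⟩ := h.bounded_m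
  refine ⟨max C 0, le_max_right _ _, fun s hs => ?_⟩
  rw [integral_eq_lintegral_of_nonneg_ae (ae_of_all _ fun z => by positivity) (by fun_prop)]
  refine ENNReal.toReal_le_of_le_ofReal (le_max_right _ _) ((hC s hs).trans ?_)
  exact ENNReal.ofReal_le_ofReal (le_max_left _ _)

theorem integrableOn_of_le_min (h : Admissible γ b c m) {s A : ℝ} (hs : 0 ≤ s) {f : ℝ → ℝ}
    (hf : Measurable f) (hA : ∀ z, 0 < z → |f z| ≤ A * min 1 (z ^ 2)) :
    IntegrableOn f (Ioi 0) (m s) :=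
  Integrable.mono' ((h.integrableOn_min hs).const_mul A) hf.aestronglyMeasurable
    ((ae_restrict_iff' measurableSet_Ioi).2 (ae_of_all _ hA))

theorem abs_integral_le_of_le_min (h : Admissible γ b c m) {s A : ℝ} (hs : 0 ≤ s) {f : ℝ → ℝ}
    (hf : Measurable f) (hA : ∀ z, 0 < z → |f z| ≤ A * min 1 (z ^ 2)) :
    |∫ z in Ioi (0 : ℝ), f z ∂(m s)| ≤ A * ∫ z in Ioi (0 : ℝ), min 1 (z ^ 2) ∂(m s) := by
  rw [← integral_const_mul]
  refine abs_integral_le_integral_abs.trans ?_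
  exact setIntegral_mono_on (h.integrableOn_of_le_min hs hf hA).abs
    ((h.integrableOn_min hs).const_mul A) measurableSet_Ioi hA

theorem integrableOn_K1 (h : Admissible γ b c m) {s x : ℝ} (hs : 0 ≤ s) (hx : 0 ≤ x) :
    IntegrableOn (K1 x) (Ioi 0) (m s) :=
  h.integrableOn_of_le_min hs (measurable_K1 x) fun _ hz => abs_K1_le hx le_rfl hz

/-- Measurability for fixed `x` needs no s-finiteness of the kernel; joint measurability is obtained
from it by continuity in `x`. -/
theorem measurable_phi (h : Admissible γ b c m) (x : ℝ) : Measurable fun s => phi b c m s x := by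
  unfold phi
  refine ((h.measurable_b.mul_const _).add (h.measurable_c.mul_const _)).add ?_
  have := ((measurable_K1 x).indicator (measurableSet_Ioi (a := (0 : ℝ)))).stronglyMeasurable
    |>.integral_kernel (κ := m)
  simpa only [integral_indicator (measurableSet_Ioi (a := (0 : ℝ)))] using this.measurable

theorem exists_abs_phi_le (h : Admissible γ b c m) {M : ℝ} (hM : 0 ≤ M) :
    ∃ C : ℝ, 0 < C ∧ ∀ s x, 0 ≤ s → 0 ≤ x → x ≤ M → |phi b c m s x| ≤ C := by
  obtain ⟨C1, h1⟩ := h.bounded_b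
  obtain ⟨C2, h2⟩ := h.bounded_c
  obtain ⟨C3, h30, h3⟩ := h.exists_integral_min_le
  have h10 : 0 ≤ C1 := (abs_nonneg _).trans (h1 0 le_rfl)
  have h20 : 0 ≤ C2 := (abs_nonneg _).trans (h2 0 le_rfl)
  refine ⟨C1 * M + C2 * M ^ 2 + (1 + M ^ 2) * C3 + 1, by positivity, fun s x hs hx hxM => ?_⟩
  unfold phi
  have a1 : |b s * x| ≤ C1 * M := by
    rw [abs_mul, abs_of_nonneg hx]; exact mul_le_mul (h1 s hs) hxM hx h10
  have a2 : |c s * x ^ 2| ≤ C2 * M ^ 2 := by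
    rw [abs_mul, abs_of_nonneg (sq_nonneg x)]
    exact mul_le_mul (h2 s hs) (by gcongr) (sq_nonneg x) h20
  have a3 : |∫ z in Ioi (0 : ℝ), K1 x z ∂(m s)| ≤ (1 + M ^ 2) * C3 :=
    (h.abs_integral_le_of_le_min hs (measurable_K1 x) fun z hz => abs_K1_le hx hxM hz).trans
      (mul_le_mul_of_nonneg_left (h3 s hs) (by positivity))
  refine (abs_add_le _ _).trans ?_
  have := abs_add_le (b s * x) (c s * x ^ 2)
  linarith

theorem exists_phi_lipschitz (h : Admissible γ b c m) {ε M : ℝ} (hε : 0 < ε) (hM : ε ≤ M) :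
    ∃ L : ℝ, 0 < L ∧ ∀ s, 0 ≤ s → ∀ x ∈ Icc ε M, ∀ y ∈ Icc ε M,
      |phi b c m s x - phi b c m s y| ≤ L * |x - y| := by
  obtain ⟨C1, h1⟩ := h.bounded_b
  obtain ⟨C2, h2⟩ := h.bounded_c
  obtain ⟨C3, h30, h3⟩ := h.exists_integral_min_le
  have h10 : 0 ≤ C1 := (abs_nonneg _).trans (h1 0 le_rfl)
  have h20 : 0 ≤ C2 := (abs_nonneg _).trans (h2 0 le_rfl)
  have hM0 : 0 < M := hε.trans_le hM
  refine ⟨C1 + C2 * (2 * M) + (M + 1 / ε) * C3 + 1, by positivity, fun s hs x hx y hy => ?_⟩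
  have hx0 : 0 ≤ x := hε.le.trans hx.1
  have hy0 : 0 ≤ y := hε.le.trans hy.1
  have e : phi b c m s x - phi b c m s y = b s * (x - y) + c s * ((x + y) * (x - y)) +
      ∫ z in Ioi (0 : ℝ), (K1 x z - K1 y z) ∂(m s) := by
    rw [integral_sub (h.integrableOn_K1 hs hx0) (h.integrableOn_K1 hs hy0)]
    unfold phi; ring
  have a1 : |b s * (x - y)| ≤ C1 * |x - y| := by
    rw [abs_mul]; exact mul_le_mul_of_nonneg_right (h1 s hs) (abs_nonneg _)
  have a2 : |c s * ((x + y) * (x - y))| ≤ C2 * (2 * M) * |x - y| := by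
    rw [abs_mul, abs_mul, ← mul_assoc, abs_of_nonneg (add_nonneg hx0 hy0)]
    have := h2 s hs
    have := hx.2
    have := hy.2
    gcongr
    linarith
  have a3 : |∫ z in Ioi (0 : ℝ), (K1 x z - K1 y z) ∂(m s)| ≤ (M + 1 / ε) * C3 * |x - y| := by
    refine (h.abs_integral_le_of_le_min hs ((measurable_K1 x).sub (measurable_K1 y))
      fun z hz => abs_K1_sub_le hε hx hy hz).trans ?_
    calc _ ≤ (M + 1 / ε) * |x - y| * C3 := mul_le_mul_of_nonneg_left (h3 s hs) (by positivity)
      _ = _ := by ring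
  rw [e]
  refine (abs_add_le _ _).trans ?_
  have := abs_add_le (b s * (x - y)) (c s * ((x + y) * (x - y)))
  nlinarith [abs_nonneg (x - y)]

theorem exists_neg_phi_le (h : Admissible γ b c m) :
    ∃ B : ℝ, 0 < B ∧ ∀ s x, 0 ≤ s → 0 ≤ x → -phi b c m s x ≤ B * (x + 1) := by
  obtain ⟨C1, h1⟩ := h.bounded_b
  obtain ⟨C3, h30, h3⟩ := h.exists_integral_min_le
  have h10 : 0 ≤ C1 := (abs_nonneg _).trans (h1 0 le_rfl)
  refine ⟨C1 + C3 + 1, by positivity, fun s x hs hx => ?_⟩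
  have a1 : -C1 * x ≤ b s * x := mul_le_mul_of_nonneg_right (abs_le.1 (h1 s hs)).1 hx
  have a2 : 0 ≤ c s * x ^ 2 := mul_nonneg (h.c_nonneg s hs) (sq_nonneg x)
  have a3 : -C3 ≤ ∫ z in Ioi (0 : ℝ), K1 x z ∂(m s) := by
    refine (neg_le_neg (h3 s hs)).trans ?_
    rw [← integral_neg]
    exact setIntegral_mono_on (h.integrableOn_min hs).neg (h.integrableOn_K1 hs hx)
      measurableSet_Ioi fun z hz => neg_min_le_K1 hz
  unfold phi
  nlinarith

/-- Convexity of `φ(s, ·)` together with `φ(s, 0) = 0`. -/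
theorem phi_le_div_mul (h : Admissible γ b c m) {s x M : ℝ} (hs : 0 ≤ s) (hM : 0 < M)
    (hx : 0 ≤ x) (hxM : x ≤ M) : phi b c m s x ≤ x / M * phi b c m s M := by
  have a3 : ∫ z in Ioi (0 : ℝ), K1 x z ∂(m s) ≤ x / M * ∫ z in Ioi (0 : ℝ), K1 M z ∂(m s) := by
    rw [← integral_const_mul]
    exact setIntegral_mono_on (h.integrableOn_K1 hs hx) ((h.integrableOn_K1 hs hM.le).const_mul _)
      measurableSet_Ioi fun z _ => K1_le_div_mul hM hx hxM
  have a1 : b s * x = x / M * (b s * M) := by field_simp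
  have a2 : c s * x ^ 2 ≤ x / M * (c s * M ^ 2) := by
    have : x / M * (c s * M ^ 2) = c s * (x * M) := by field_simp
    rw [this, sq]
    exact mul_le_mul_of_nonneg_left (mul_le_mul_of_nonneg_left hxM hx) (h.c_nonneg s hs)
  unfold phi
  rw [a1]
  nlinarith

/-- At an atom `s` of `γ` the map `x ↦ x - φ(s, x) γ({s})` sends positive numbers to positive
numbers: it is `x (1 - [b₁ + ∫_{(0,1]} z m] γ({s})) + γ({s}) ∫ (1 - e^{-xz}) m`, both terms are
nonnegative, and they cannot vanish together. -/
theorem sub_phi_mul_atom_pos (h : Admissible γ b c m) {s x : ℝ} (hs : 0 < s) (hx : 0 < x) :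
    0 < x - phi b c m s x * γ.measure.real {s} := by
  set δ := γ.measure.real {s} with hδ
  have hδ0 : 0 ≤ δ := measureReal_nonneg
  rcases eq_or_ne δ 0 with h0 | h0
  · rw [h0]; simpa using hx
  obtain ⟨hz, hle⟩ := h.atom_le s hs h0
  have hc : c s * δ = 0 := h.c_atom s hs
  have hzi : IntegrableOn ((Ioc (0 : ℝ) 1).indicator fun z => x * z) (Ioi 0) (m s) :=
    ((integrable_indicator_iff measurableSet_Ioc).2 (hz.const_mul x)).integrableOn
  have hK : ∀ z ∈ Ioi (0 : ℝ), K1 x z =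
      (Ioc (0 : ℝ) 1).indicator (fun z => x * z) z - (1 - Real.exp (-x * z)) := by
    intro z hz0
    unfold K1
    by_cases h1 : z ≤ 1
    · rw [indicator_of_mem (show z ∈ Ioc (0 : ℝ) 1 from ⟨hz0, h1⟩), if_pos h1]; ring
    · rw [indicator_of_notMem (fun h' => h1 h'.2), if_neg h1]; ring
  have he : IntegrableOn (fun z => 1 - Real.exp (-x * z)) (Ioi 0) (m s) := by
    have := hzi.sub (h.integrableOn_K1 hs.le hx.le)
    refine this.congr_fun (fun z hz0 => ?_) measurableSet_Ioi
    have := hK z hz0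
    simp only [Pi.sub_apply]
    linarith
  have hKint : ∫ z in Ioi (0 : ℝ), K1 x z ∂(m s) =
      x * ∫ z in Ioc (0 : ℝ) 1, z ∂(m s) - ∫ z in Ioi (0 : ℝ), (1 - Real.exp (-x * z)) ∂(m s) := by
    rw [setIntegral_congr_fun measurableSet_Ioi hK, integral_sub hzi he,
      setIntegral_indicator measurableSet_Ioc, inter_eq_right.2 Ioc_subset_Ioi_self,
      integral_const_mul]
  set I := ∫ z in Ioi (0 : ℝ), (1 - Real.exp (-x * z)) ∂(m s) with hI
  set Z := ∫ z in Ioc (0 : ℝ) 1, z ∂(m s) with hZ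
  have hnn : ∀ z ∈ Ioi (0 : ℝ), 0 ≤ 1 - Real.exp (-x * z) := fun z hz0 =>
    sub_nonneg.2 (Real.exp_le_one_iff.2 (by nlinarith [mul_pos hx (mem_Ioi.1 hz0)]))
  have hI0 : 0 ≤ I := setIntegral_nonneg measurableSet_Ioi hnn
  have e : x - phi b c m s x * δ = x * (1 - (b s + Z) * δ) + δ * I := by
    unfold phi
    rw [hKint]
    linear_combination (-x ^ 2) * hc
  rw [e]
  have hδp : 0 < δ := lt_of_le_of_ne hδ0 (Ne.symm h0)
  rcases hI0.eq_or_lt with hI0 | hI0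
  · -- The jump measure vanishes, so the first term is `x (1 - b₁(s) γ({s}))`.
    have hae := (setIntegral_eq_zero_iff_of_nonneg_ae
      ((ae_restrict_iff' measurableSet_Ioi).2 (ae_of_all _ hnn)) he).1 hI0.symm
    have hnull : m s (Ioi 0) = 0 := by
      rw [← Measure.restrict_eq_zero, ← ae_eq_bot]
      rw [← Filter.eventually_false_iff_eq_bot]
      filter_upwards [hae, ae_restrict_mem measurableSet_Ioi] with z h1 h2
      have : Real.exp (-x * z) < 1 := Real.exp_lt_one_iff.2 (by
        nlinarith [mul_pos hx (mem_Ioi.1 h2)])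
      simp only [Pi.zero_apply] at h1
      linarith
    have hZ0 : Z = 0 := by
      rw [hZ]
      exact setIntegral_measure_zero _ (measure_mono_null Ioc_subset_Ioi_self hnull)
    have hne : b s * δ ≠ 1 := by
      intro hb
      have h2 := h.atom_pos s hs hb
      rw [measure_mono_null (Ioi_subset_Ioi zero_le_one) hnull, zero_mul] at h2
      exact lt_irrefl _ h2
    rw [hZ0, add_zero] at hle ⊢
    rw [← hI0, mul_zero, add_zero]
    exact mul_pos hx (sub_pos.2 (lt_of_le_of_ne hle hne))
  · have : 0 ≤ x * (1 - (b s + Z) * δ) := mul_nonneg hx.le (sub_nonneg.2 hle)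
    have := mul_pos hδp hI0
    linarith

end Admissible

/-! ### Backward Stieltjes integral equations -/

/-- `w(r) = λ - ∫_{(r,t]} f dγ` on `[0, t]`, with `f` integrable. -/
structure IsBackwardIntegral (γ : StieltjesFunction ℝ) (t lam : ℝ) (f w : ℝ → ℝ) : Prop where
  integrableOn : IntegrableOn f (Ioc 0 t) γ.measure
  eq : ∀ r ∈ Icc 0 t, w r = lam - ∫ s in Ioc r t, f s ∂γ.measure

namespace IsBackwardIntegral

variable {γ : StieltjesFunction ℝ} {t lam : ℝ} {f w : ℝ → ℝ}

theorem integrableOn_Ioc (h : IsBackwardIntegral γ t lam f w) {x y : ℝ} (hx : 0 ≤ x)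
    (hy : y ≤ t) : IntegrableOn f (Ioc x y) γ.measure :=
  h.integrableOn.mono_set (Ioc_subset_Ioc hx hy)

theorem apply_end (h : IsBackwardIntegral γ t lam f w) (ht : 0 ≤ t) : w t = lam := by
  rw [h.eq t ⟨ht, le_rfl⟩]; simp

theorem eq_sub (h : IsBackwardIntegral γ t lam f w) {x y : ℝ} (hx : 0 ≤ x) (hxy : x ≤ y)
    (hy : y ≤ t) : w x = w y - ∫ s in Ioc x y, f s ∂γ.measure := by
  rw [h.eq x ⟨hx, hxy.trans hy⟩, h.eq y ⟨hx.trans hxy, hy⟩, ← Ioc_union_Ioc_eq_Ioc hxy hy,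
    setIntegral_union (Ioc_disjoint_Ioc_of_le le_rfl) measurableSet_Ioc
      (h.integrableOn_Ioc hx hy) (h.integrableOn_Ioc (hx.trans hxy) le_rfl)]
  ring

/-- The same identity with the atom at the right end point split off. -/
theorem eq_sub_atom (h : IsBackwardIntegral γ t lam f w) {x y : ℝ} (hx : 0 ≤ x) (hxy : x < y)
    (hy : y ≤ t) :
    w x = w y - f y * γ.measure.real {y} - ∫ s in Ioo x y, f s ∂γ.measure := by
  have hi := h.integrableOn_Ioc hx hy
  rw [h.eq_sub hx hxy.le hy, ← Ioo_union_right hxy,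
    setIntegral_union (by simp) (measurableSet_singleton y)
      (hi.mono_set Ioo_subset_Ioc_self) (hi.mono_set (by simpa using hxy)),
    integral_singleton, smul_eq_mul]
  ring

/-- `w` is a constant minus a difference of two antitone functions. -/
theorem aestronglyMeasurable (h : IsBackwardIntegral γ t lam f w) :
    AEStronglyMeasurable w (γ.measure.restrict (Ioc 0 t)) := by
  have hanti : ∀ g : ℝ → ℝ, (∀ s, 0 ≤ g s) → IntegrableOn g (Ioc 0 t) γ.measure →
      AEMeasurable (fun r => ∫ s in Ioc r t, g s ∂γ.measure) (γ.measure.restrict (Ioc 0 t)) := by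
    intro g hg hgi
    refine aemeasurable_restrict_of_antitoneOn measurableSet_Ioc fun r hr r' _ hrr => ?_
    exact setIntegral_mono_set (hgi.mono_set (Ioc_subset_Ioc_left hr.1.le)) (ae_of_all _ hg)
      (Ioc_subset_Ioc_left hrr).eventuallyLE
  have h1 := hanti (fun s => f s + |f s|) (fun s => by linarith [neg_abs_le (f s)])
    (h.integrableOn.add h.integrableOn.abs)
  have h2 := hanti (fun s => |f s|) (fun s => abs_nonneg _) h.integrableOn.abs
  refine ((h1.sub h2).const_sub lam).aestronglyMeasurable.congr ?_
  refine (ae_restrict_iff' measurableSet_Ioc).2 (ae_of_all _ fun r hr => ?_)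
  have hi := h.integrableOn_Ioc hr.1.le le_rfl
  simp only [Pi.sub_apply]
  rw [h.eq r ⟨hr.1.le, hr.2⟩, integral_add hi hi.abs]
  ring

theorem abs_sub_le (h : IsBackwardIntegral γ t lam f w) {C x y : ℝ}
    (hC : ∀ s ∈ Ioc 0 t, |f s| ≤ C) (hx : 0 ≤ x) (hxy : x ≤ y) (hy : y ≤ t) :
    |w x - w y| ≤ C * (γ y - γ x) := by
  rw [h.eq_sub hx hxy hy, show ∀ a b : ℝ, a - b - a = -b by intros; ring, abs_neg]
  exact abs_setIntegral_Ioc_le γ hxy fun s hs => hC s ⟨hx.trans_lt hs.1, hs.2.trans hy⟩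

/-- A Gronwall upper bound for `w` that does not depend on the size of the positive part of `f`. -/
theorem le_of_neg_le (h : IsBackwardIntegral γ t lam f w) {B : ℝ} (hB : 0 < B) (hlam : 0 ≤ lam)
    (hf : ∀ s ∈ Ioc 0 t, -f s ≤ B * (max (w s) 1 + 1)) :
    ∀ r ∈ Icc 0 t, w r ≤ 2 * (lam + 1 + B * (γ t - γ 0)) * Real.exp (2 * B * (γ t - γ 0)) := by
  intro r hr
  have ht : 0 ≤ t := hr.1.trans hr.2
  have hΓ : 0 ≤ γ t - γ 0 := sub_nonneg.2 (γ.mono ht)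
  have hm : AEStronglyMeasurable (fun r => max (w r) 1) (γ.measure.restrict (Ioc 0 t)) :=
    h.aestronglyMeasurable.sup aestronglyMeasurable_const
  set D := lam + 1 + ∫ s in Ioc 0 t, |f s| ∂γ.measure with hD
  have hbd : ∀ r ∈ Icc 0 t, |max (w r) 1| ≤ D := by
    intro r hr
    have h0 : 0 ≤ ∫ s in Ioc 0 t, |f s| ∂γ.measure := integral_nonneg fun s => abs_nonneg _
    rw [abs_of_nonneg (by positivity)]
    refine max_le ?_ (by linarith)
    rw [h.eq r hr]
    have h1 : |∫ s in Ioc r t, f s ∂γ.measure| ≤ ∫ s in Ioc 0 t, |f s| ∂γ.measure :=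
      abs_integral_le_integral_abs.trans (setIntegral_mono_set h.integrableOn.abs
        (ae_of_all _ fun s => abs_nonneg _) (Ioc_subset_Ioc_left hr.1).eventuallyLE)
    linarith [neg_abs_le (∫ s in Ioc r t, f s ∂γ.measure)]
  have hg := gronwall γ (y := fun r => max (w r) 1) (A := lam + 1 + B * (γ t - γ 0)) hB
    (by positivity) hm hbd ?_ r hr
  · have hr' := γ.mono hr.1
    refine (le_max_left _ _).trans (hg.trans ?_)
    gcongr
  · intro r hr
    have hyi : IntegrableOn (fun r => max (w r) 1) (Ioc r t) γ.measure :=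
      integrableOn_of_bounded γ (hm.mono_measure (Measure.restrict_mono
        (Ioc_subset_Ioc_left hr.1) le_rfl)) fun s hs => hbd s ⟨hr.1.trans hs.1.le, hs.2⟩
    have hci : IntegrableOn (fun _ : ℝ => (1 : ℝ)) (Ioc r t) γ.measure :=
      integrableOn_const (measure_Ioc_ne_top γ r t)
    have h0 : 0 ≤ ∫ s in Ioc r t, max (w s) 1 ∂γ.measure :=
      integral_nonneg fun s => by positivity
    have h1 : -∫ s in Ioc r t, f s ∂γ.measure ≤
        B * (∫ s in Ioc r t, max (w s) 1 ∂γ.measure + (γ t - γ r)) := by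
      have e : γ t - γ r = ∫ s in Ioc r t, (1 : ℝ) ∂γ.measure := by
        rw [setIntegral_const, measureReal_Ioc γ hr.2, smul_eq_mul, mul_one]
      rw [← integral_neg, e, ← integral_add hyi hci, ← integral_const_mul]
      exact setIntegral_mono_on (h.integrableOn_Ioc hr.1 le_rfl).neg
        ((hyi.add hci).const_mul B) measurableSet_Ioc
        fun s hs => hf s ⟨hr.1.trans_lt hs.1, hs.2⟩
    have h2 : B * (γ t - γ r) ≤ B * (γ t - γ 0) :=
      mul_le_mul_of_nonneg_left (by linarith [γ.mono hr.1]) hB.le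
    refine max_le ?_ ?_
    · rw [h.eq r hr]; linarith
    · nlinarith [mul_nonneg hB.le hΓ, mul_nonneg hB.le h0]

/-- Going backwards over a stretch of small `γ`-mass, `w` cannot fall far below a level `A` that
it has reached: up to the first time `y₀ ≥ x` at which `w ≥ A`, the integrand is at most
`C₁ w(y₀)`. -/
theorem le_of_le_of_mass_le (h : IsBackwardIntegral γ t lam f w) {C C₁ ε A x y : ℝ}
    (hC : ∀ s ∈ Ioc 0 t, |f s| ≤ C) (hC₁ : 0 ≤ C₁)
    (hf : ∀ s ∈ Ioc 0 t, f s ≤ C₁ * max (w s) ε) (hε : ε ≤ A) (hA : 0 < A)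
    (hx : 0 ≤ x) (hxy : x ≤ y) (hy : y ≤ t) (hmass : C₁ * (γ y - γ x) ≤ 1 / 6) (hwy : A ≤ w y) :
    2 / 3 * A ≤ w x := by
  set Y : Set ℝ := {z | z ∈ Icc x y ∧ A ≤ w z} with hY
  have hYne : Y.Nonempty := ⟨y, ⟨hxy, le_rfl⟩, hwy⟩
  have hYb : BddBelow Y := ⟨x, fun z hz => hz.1.1⟩
  set y₀ := sInf Y with hy₀
  have hxy₀ : x ≤ y₀ := le_csInf hYne fun z hz => hz.1.1
  have hy₀y : y₀ ≤ y := csInf_le hYb ⟨⟨hxy, le_rfl⟩, hwy⟩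
  have hwy₀ : A ≤ w y₀ := by
    refine le_of_forall_pos_le_add fun η hη => ?_
    have hC0 : 0 ≤ |C| + 1 := by positivity
    have hev : ∀ᶠ z in 𝓝[≥] y₀, γ z < γ y₀ + η / (|C| + 1) :=
      (γ.right_continuous y₀).eventually (Iio_mem_nhds (by
        have : 0 < η / (|C| + 1) := by positivity
        linarith))
    obtain ⟨u, hu, hu'⟩ := mem_nhdsGE_iff_exists_Ico_subset.1 hev
    obtain ⟨z, hz, hzu⟩ := exists_lt_of_csInf_lt hYne hu
    have hz0 : y₀ ≤ z := csInf_le hYb hz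
    have h1 : γ z < γ y₀ + η / (|C| + 1) := hu' ⟨hz0, hzu⟩
    have h2 := h.abs_sub_le hC (hx.trans hxy₀) hz0 (hz.1.2.trans hy)
    have h3 : C * (γ z - γ y₀) ≤ η := by
      have h4 : (|C| + 1) * (γ z - γ y₀) ≤ η := by
        rw [← le_div_iff₀' (by positivity)]; linarith
      nlinarith [le_abs_self C, γ.mono hz0]
    have h5 := hz.2
    linarith [neg_abs_le (w y₀ - w z)]
  have hlt : ∀ z ∈ Ioc x y₀, w z ≤ w y₀ := by
    intro z hz
    rcases eq_or_lt_of_le hz.2 with e | e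
    · rw [e]
    · by_contra hcon
      exact not_lt.2 (csInf_le hYb ⟨⟨hz.1.le, hz.2.trans hy₀y⟩,
        hwy₀.trans (not_le.1 hcon).le⟩) e
  have hint : ∫ s in Ioc x y₀, f s ∂γ.measure ≤ C₁ * w y₀ * (γ y₀ - γ x) := by
    have e : C₁ * w y₀ * (γ y₀ - γ x) = ∫ s in Ioc x y₀, C₁ * w y₀ ∂γ.measure := by
      rw [setIntegral_const, measureReal_Ioc γ hxy₀, smul_eq_mul]; ring
    rw [e]
    refine setIntegral_mono_on (h.integrableOn_Ioc hx (hy₀y.trans hy))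
      (integrableOn_const (measure_Ioc_ne_top γ _ _)) measurableSet_Ioc fun s hs => ?_
    exact (hf s ⟨hx.trans_lt hs.1, hs.2.trans (hy₀y.trans hy)⟩).trans
      (mul_le_mul_of_nonneg_left (max_le (hlt s hs) (hε.trans hwy₀)) hC₁)
  rw [h.eq_sub hx hxy₀ (hy₀y.trans hy)]
  have hm : C₁ * (γ y₀ - γ x) ≤ 1 / 6 :=
    (mul_le_mul_of_nonneg_left (by linarith [γ.mono hy₀y]) hC₁).trans hmass
  nlinarith

end IsBackwardIntegral

/-! ### Jumps of the discretised time scale -/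

section Scale

variable {γ : StieltjesFunction ℝ} {β : ℝ}

theorem apply_nonneg (h0 : γ 0 = 0) {s : ℝ} (hs : 0 ≤ s) : 0 ≤ γ s := h0 ▸ γ.mono hs

theorem le_scale_iff (h0 : γ 0 = 0) (hβ : 0 < β) {s : ℝ} (hs : 0 ≤ s) {i : ℕ} :
    i ≤ scale γ β s ↔ (i : ℝ) / β ≤ γ s := by
  rw [scale, Nat.le_floor_iff (mul_nonneg hβ.le (apply_nonneg h0 hs)), div_le_iff₀' hβ]

/-- The infimum defining `γ_k^{-1}(i)` is attained. -/
theorem scaleInv_mem (h0 : γ 0 = 0) (hβ : 0 < β) {i : ℕ} {t : ℝ} (ht : 0 ≤ t)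
    (hi : i ≤ scale γ β t) :
    0 ≤ scaleInv γ β i ∧ scaleInv γ β i ≤ t ∧ i ≤ scale γ β (scaleInv γ β i) ∧
      ∀ s, 0 ≤ s → i ≤ scale γ β s → scaleInv γ β i ≤ s := by
  have hne : {s : ℝ | 0 ≤ s ∧ i ≤ scale γ β s}.Nonempty := ⟨t, ht, hi⟩
  have hb : BddBelow {s : ℝ | 0 ≤ s ∧ i ≤ scale γ β s} := ⟨0, fun s hs => hs.1⟩
  have h1 : 0 ≤ scaleInv γ β i := le_csInf hne fun s hs => hs.1
  refine ⟨h1, csInf_le hb ⟨ht, hi⟩, ?_, fun s hs hs' => csInf_le hb ⟨hs, hs'⟩⟩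
  rw [le_scale_iff h0 hβ h1]
  refine le_apply_of_forall_gt γ fun y hy => ?_
  obtain ⟨s, hs, hsy⟩ := exists_lt_of_csInf_lt hne hy
  exact ((le_scale_iff h0 hβ hs.1).1 hs.2).trans (γ.mono hsy.le)

/-- The left end point of the block of constancy of `γ_k` that contains `r`. -/
theorem scaleInv_scale (h0 : γ 0 = 0) (hβ : 0 < β) {r : ℝ} (hr : 0 ≤ r) :
    0 ≤ scaleInv γ β (scale γ β r) ∧ scaleInv γ β (scale γ β r) ≤ r ∧
      scale γ β (scaleInv γ β (scale γ β r)) = scale γ β r := by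
  obtain ⟨h1, h2, h3, -⟩ := scaleInv_mem h0 hβ hr le_rfl
  exact ⟨h1, h2, le_antisymm (scale_mono γ hβ.le h2) h3⟩

theorem apply_lt_of_scale_le (hβ : 0 < β) {s : ℝ} {i : ℕ} (h : scale γ β s ≤ i) :
    γ s < (i + 1) / β := by
  rw [lt_div_iff₀' hβ]
  have h1 := Nat.lt_floor_add_one (β * γ s)
  have h2 : ((scale γ β s : ℕ) : ℝ) ≤ i := by exact_mod_cast h
  unfold scale at h2
  linarith

theorem sub_le_of_scale_eq (h0 : γ 0 = 0) (hβ : 0 < β) {r s : ℝ} (hr : 0 ≤ r)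
    (h : scale γ β s = scale γ β r) : γ s - γ r ≤ 1 / β := by
  have h1 := apply_lt_of_scale_le hβ h.le
  have h2 := (le_scale_iff h0 hβ hr).1 le_rfl
  rw [add_div] at h1
  linarith

/-- The first jump of `γ_k` after `r`, and its properties. -/
theorem exists_next_jump (h0 : γ 0 = 0) (hβ : 0 < β) {r t : ℝ} (hr : 0 ≤ r)
    (ht : 0 ≤ t) (h : scale γ β r < scale γ β t) :
    ∃ s, r < s ∧ s ≤ t ∧ scale γ β r < scale γ β s ∧ scaleLeft γ β s = scale γ β r ∧
      scaleInv γ β (scale γ β s) = s ∧ (∀ y, r ≤ y → y < s → scale γ β y = scale γ β r) ∧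
      γ.measure.real (Ioo (scaleInv γ β (scale γ β r)) s) ≤ 1 / β := by
  obtain ⟨h1, h2, h3, h4⟩ := scaleInv_mem h0 hβ ht (Nat.succ_le_of_lt h)
  set s := scaleInv γ β (scale γ β r + 1) with hs
  have hmono := scale_mono γ hβ.le
  have hrs : r < s := by
    by_contra hcon
    have := hmono (not_lt.1 hcon)
    omega
  have hconst : ∀ y, r ≤ y → y < s → scale γ β y = scale γ β r := by
    intro y hy hys
    refine le_antisymm ?_ (hmono hy)
    by_contra hcon
    exact absurd (h4 y (hr.trans hy) (by omega)) (not_le.2 hys)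
  have hev : ∀ᶠ y in 𝓝[<] s, r ≤ y ∧ y < s :=
    eventually_of_mem (Ico_mem_nhdsLT hrs) fun y hy => hy
  refine ⟨s, hrs, h2, by omega, ?_, ?_, hconst, ?_⟩
  · refine leftLim_eq_of_tendsto ?_
    exact tendsto_const_nhds.congr' (hev.mono fun y hy => (hconst y hy.1 hy.2).symm)
  · obtain ⟨-, g2, -, -⟩ := scaleInv_mem h0 hβ h1 (le_refl (scale γ β s))
    refine le_antisymm g2 (h4 _ (scaleInv_scale h0 hβ h1).1 ?_)
    rw [(scaleInv_scale h0 hβ h1).2.2]; omega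
  · have hl : Function.leftLim γ s ≤ (scale γ β r + 1) / β := by
      refine le_of_tendsto (γ.mono.tendsto_leftLim s) (hev.mono fun y hy => ?_)
      exact (apply_lt_of_scale_le hβ (hconst y hy.1 hy.2).le).le
    obtain ⟨g1, -, g3⟩ := scaleInv_scale h0 hβ hr
    have h5 := (le_scale_iff h0 hβ g1).1 g3.ge
    rw [add_div] at hl
    rw [Measure.real, γ.measure_Ioo]
    exact ENNReal.toReal_le_of_le_ofReal (by positivity)
      (ENNReal.ofReal_le_ofReal (by linarith))

theorem measureReal_Ioo_add_atom (γ : StieltjesFunction ℝ) {x y : ℝ} (hxy : x < y) :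
    γ.measure.real (Ioo x y) + γ.measure.real {y} = γ y - γ x := by
  have hne := measure_Ioc_ne_top γ x y
  rw [← measureReal_Ioc γ hxy.le, ← Ioo_union_right hxy]
  rw [← Ioo_union_right hxy] at hne
  exact (measureReal_union (by simp) (measurableSet_singleton y)
    (ne_top_of_le_ne_top hne (measure_mono subset_union_left))
    (ne_top_of_le_ne_top hne (measure_mono subset_union_right))).symm

end Scale

/-! ### A priori bounds, existence and uniqueness -/

/-- Lower bound by backward induction over the blocks of `⌊β γ⌋`: inside a block the loss is
controlled by `IsBackwardIntegral.le_of_le_of_mass_le`, at the jump times by the factor `κ`. -/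
theorem IsBackwardIntegral.le_of_atom {γ : StieltjesFunction ℝ} {t lam : ℝ} {f w : ℝ → ℝ}
    (h : IsBackwardIntegral γ t lam f w) {β C C₁ ε κ : ℝ} (h0 : γ 0 = 0) (hβ : 0 < β)
    (hC : ∀ s ∈ Ioc 0 t, |f s| ≤ C) (hC₁ : 0 ≤ C₁) (hε : 0 < ε) (hlam : 0 < lam)
    (hf : ∀ s ∈ Ioc 0 t, f s ≤ C₁ * max (w s) ε) (hβC : C₁ * (1 / β) ≤ 1 / 6)
    (hκ : 0 < κ) (hκ1 : κ ≤ 1)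
    (hatom : ∀ s ∈ jumpSet γ β 0 t, ε ≤ w s → κ * w s ≤ w s - f s * γ.measure.real {s})
    (hεle : ε ≤ lam / 2 * (κ / 2) ^ scale γ β t) :
    ∀ r ∈ Icc 0 t, ε ≤ w r := by
  have hstep : ∀ n, n ≤ scale γ β t → ε ≤ lam / 2 * (κ / 2) ^ n := fun n hn =>
    hεle.trans (mul_le_mul_of_nonneg_left
      (pow_le_pow_of_le_one (by positivity) (by linarith) hn) (by positivity))
  suffices H : ∀ n r, r ∈ Icc 0 t → scale γ β t - scale γ β r = n →
      lam / 2 * (κ / 2) ^ n ≤ w r by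
    intro r hr
    exact (hstep _ (Nat.sub_le _ _)).trans (H _ r hr rfl)
  intro n
  induction n using Nat.strong_induction_on with
  | _ n ih =>
  intro r hr hn
  have ht : 0 ≤ t := hr.1.trans hr.2
  have hmono := scale_mono γ hβ.le
  rcases (hmono hr.2).eq_or_lt with heq | hlt
  · have hw := h.le_of_le_of_mass_le hC hC₁ hf (A := lam) (x := r) (y := t)
      ((hstep 0 (Nat.zero_le _)).trans (by rw [pow_zero]; linarith)) hlam hr.1 hr.2 le_rfl
      ((mul_le_mul_of_nonneg_left (sub_le_of_scale_eq h0 hβ hr.1 heq.symm) hC₁).trans hβC)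
      (h.apply_end ht).ge
    have hn0 : n = 0 := by omega
    rw [hn0, pow_zero]
    linarith
  · obtain ⟨s, hrs, hst, hsc, hleft, -, hconst, hmass⟩ := exists_next_jump h0 hβ hr.1 ht hlt
    have hs0 : 0 < s := hr.1.trans_lt hrs
    have hle := hmono hst
    set n' := scale γ β t - scale γ β s with hn'
    have hws : lam / 2 * (κ / 2) ^ n' ≤ w s := ih n' (by omega) s ⟨hs0.le, hst⟩ rfl
    have hεs : ε ≤ w s := (hstep n' (Nat.sub_le _ _)).trans hws
    have hws0 : 0 < w s := hε.trans_le hεs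
    set A := w s - f s * γ.measure.real {s} with hA
    have hAκ : κ * w s ≤ A := hatom s ⟨⟨hs0, hst⟩, by omega⟩ hεs
    have hA0 : 0 < A := lt_of_lt_of_le (by positivity) hAκ
    have hpow : lam / 2 * (κ / 2) ^ n ≤ κ / 2 * w s := by
      calc lam / 2 * (κ / 2) ^ n ≤ lam / 2 * (κ / 2) ^ (n' + 1) :=
            mul_le_mul_of_nonneg_left
              (pow_le_pow_of_le_one (by positivity) (by linarith) (by omega)) (by positivity)
        _ = κ / 2 * (lam / 2 * (κ / 2) ^ n') := by ring
        _ ≤ _ := mul_le_mul_of_nonneg_left hws (by positivity)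
    -- Close to `s` from the left, `w` is close to its left limit `A`.
    obtain ⟨y, hry, hys, hwy⟩ : ∃ y, r ≤ y ∧ y < s ∧ 3 / 4 * A ≤ w y := by
      have hlim : Tendsto (fun y => |C| * (Function.leftLim γ s - γ y)) (𝓝[<] s)
          (𝓝 (|C| * (Function.leftLim γ s - Function.leftLim γ s))) :=
        ((γ.mono.tendsto_leftLim s).const_sub _).const_mul _
      have hev := hlim.eventually_lt_const (u := A / 4) (by rw [sub_self, mul_zero]; positivity)
      obtain ⟨y, hy, hy'⟩ := (hev.and (Ico_mem_nhdsLT hrs)).exists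
      refine ⟨y, hy'.1, hy'.2, ?_⟩
      rw [h.eq_sub_atom (hr.1.trans hy'.1) hy'.2 hst]
      have h1 : ‖∫ u in Ioo y s, f u ∂γ.measure‖ ≤ |C| * γ.measure.real (Ioo y s) := by
        refine norm_setIntegral_le_of_norm_le_const
          ((measure_mono Ioo_subset_Ioc_self).trans_lt (measure_Ioc_ne_top γ y s).lt_top)
          fun u hu => ?_
        exact (hC u ⟨(hr.1.trans hy'.1).trans_lt hu.1, hu.2.le.trans hst⟩).trans (le_abs_self C)
      rw [Measure.real, γ.measure_Ioo, ENNReal.toReal_ofReal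
        (sub_nonneg.2 (γ.mono.le_leftLim hy'.2)), Real.norm_eq_abs] at h1
      have h2 : |C| * (Function.leftLim γ s - γ y) < A / 4 := hy
      have h3 := le_abs_self (∫ u in Ioo y s, f u ∂γ.measure)
      linarith
    have hw := h.le_of_le_of_mass_le hC hC₁ hf (A := 3 / 4 * A) (x := r) (y := y)
      (((hstep n (by omega)).trans hpow).trans (by linarith)) (by positivity) hr.1 hry
      (hys.le.trans hst)
      ((mul_le_mul_of_nonneg_left (sub_le_of_scale_eq h0 hβ hr.1 (hconst y hry hys)) hC₁).trans
        hβC) hwy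
    linarith

/-- Uniform bounds for backward equations driven by `φ(s, u(s))`, where `u` agrees with `w` as
long as `w` stays in `[ε, M]`. This covers both the solutions of the equation (`u = w`) and those
of the equation with the argument of `φ` truncated to `[ε, M]`. -/
theorem Admissible.exists_bounds {γ : StieltjesFunction ℝ} {b c : ℝ → ℝ} {m : Kernel ℝ ℝ}
    (h : Admissible γ b c m) {T a a' : ℝ} (hT : 0 ≤ T) (ha : 0 < a) (haa : a ≤ a') :
    ∃ ε M : ℝ, 0 < ε ∧ ε ≤ 1 ∧ 1 ≤ M ∧ ∀ t lam : ℝ, 0 ≤ t → t ≤ T → a ≤ lam → lam ≤ a' →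
      ∀ u w : ℝ → ℝ, IsBackwardIntegral γ t lam (fun s => phi b c m s (u s)) w →
      (∀ s ∈ Ioc 0 t, 0 < u s ∧ u s ≤ max (w s) ε ∧ (ε ≤ w s → w s ≤ M → u s = w s)) →
      ∀ r ∈ Icc 0 t, w r ∈ Icc ε M := by
  have h0 := h.gamma_zero
  have hΓT : 0 ≤ γ T := apply_nonneg h0 hT
  obtain ⟨B, hB, hphiB⟩ := h.exists_neg_phi_le
  set M := 2 * (a' + 1 + B * γ T) * Real.exp (2 * B * γ T) with hM
  have ha' : 0 < a' := ha.trans_le haa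
  have hM1 : 1 ≤ M := by
    have h1 : 1 ≤ Real.exp (2 * B * γ T) := Real.one_le_exp (by positivity)
    have h2 : 0 ≤ B * γ T := by positivity
    rw [hM]
    nlinarith
  have hM0 : 0 < M := by linarith
  obtain ⟨C, hC0, hC⟩ := h.exists_abs_phi_le hM0.le
  set C₁ := C / M with hC₁
  have hC₁0 : 0 < C₁ := by positivity
  set β := 6 * C₁ with hβ
  have hβ0 : 0 < β := by positivity
  obtain ⟨κ, hκ0, hκ1, hκ⟩ : ∃ κ : ℝ, 0 < κ ∧ κ ≤ 1 ∧ ∀ s ∈ jumpSet γ β 0 T,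
      κ ≤ (M - phi b c m s M * γ.measure.real {s}) / M := by
    have hfin := jumpSet_finite γ hβ0.le 0 T
    have hpos : ∀ s ∈ jumpSet γ β 0 T, 0 < (M - phi b c m s M * γ.measure.real {s}) / M :=
      fun s hs => div_pos (h.sub_phi_mul_atom_pos hs.1.1 hM0) hM0
    rcases (jumpSet γ β 0 T).eq_empty_or_nonempty with he | hne
    · exact ⟨1, one_pos, le_rfl, by simp [he]⟩
    · obtain ⟨s₀, hs₀, hmin⟩ := hfin.exists_minimalFor
        (fun s => (M - phi b c m s M * γ.measure.real {s}) / M) _ hne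
      refine ⟨min 1 ((M - phi b c m s₀ M * γ.measure.real {s₀}) / M),
        lt_min one_pos (hpos s₀ hs₀), min_le_left _ _, fun s hs => (min_le_right _ _).trans ?_⟩
      rcases le_total ((M - phi b c m s₀ M * γ.measure.real {s₀}) / M)
        ((M - phi b c m s M * γ.measure.real {s}) / M) with hc | hc
      · exact hc
      · exact hmin hs hc
  set ε := min 1 (a / 2 * (κ / 2) ^ scale γ β T) with hε
  have hε0 : 0 < ε := lt_min one_pos (by positivity)
  refine ⟨ε, M, hε0, min_le_left _ _, hM1, fun t lam ht htT hla hla' u w hw hu => ?_⟩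
  have hlam : 0 < lam := ha.trans_le hla
  have hupper : ∀ r ∈ Icc 0 t, w r ≤ M := by
    intro r hr
    have h1 := hw.le_of_neg_le hB hlam.le (fun s hs => ?_) r hr
    · refine h1.trans ?_
      have h2 := γ.mono htT
      have h3 := apply_nonneg h0 ht
      rw [hM, h0, sub_zero]
      gcongr
    · refine (hphiB s (u s) hs.1.le (hu s hs).1.le).trans ?_
      have := (hu s hs).2.1.trans (max_le_max le_rfl (min_le_left _ _) : max (w s) ε ≤ max (w s) 1)
      gcongr
  have huM : ∀ s ∈ Ioc 0 t, u s ≤ M := fun s hs =>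
    (hu s hs).2.1.trans (max_le (hupper s ⟨hs.1.le, hs.2⟩) ((min_le_left _ _).trans hM1))
  intro r hr
  refine ⟨?_, hupper r hr⟩
  refine hw.le_of_atom h0 hβ0 (C := C) (C₁ := C₁) (κ := κ) (fun s hs => ?_) hC₁0.le hε0 hlam
    (fun s hs => ?_) ?_ hκ0 hκ1 (fun s hs hεs => ?_) ?_ r hr
  · exact hC s (u s) hs.1.le (hu s hs).1.le (huM s hs)
  · have h1 := h.phi_le_div_mul hs.1.le hM0 (hu s hs).1.le (huM s hs)
    have h2 := (le_abs_self _).trans (hC s M hs.1.le hM0.le le_rfl)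
    calc phi b c m s (u s) ≤ u s / M * phi b c m s M := h1
      _ ≤ u s / M * C := mul_le_mul_of_nonneg_left h2 (div_nonneg (hu s hs).1.le hM0.le)
      _ = C₁ * u s := by rw [hC₁]; ring
      _ ≤ _ := mul_le_mul_of_nonneg_left (hu s hs).2.1 hC₁0.le
  · rw [hβ]
    field_simp
    norm_num
  · have hs' : s ∈ Ioc 0 t := hs.1
    have hws : w s ≤ M := hupper s ⟨hs'.1.le, hs'.2⟩
    have hw0 : 0 ≤ w s := hε0.le.trans hεs
    simp only [(hu s hs').2.2 hεs hws]
    have h1 := h.phi_le_div_mul hs'.1.le hM0 hw0 hws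
    have h2 := hκ s ⟨⟨hs'.1, hs'.2.trans htT⟩, hs.2⟩
    calc κ * w s ≤ (M - phi b c m s M * γ.measure.real {s}) / M * w s :=
          mul_le_mul_of_nonneg_right h2 hw0
      _ = w s - w s / M * phi b c m s M * γ.measure.real {s} := by field_simp
      _ ≤ _ := sub_le_sub_left (mul_le_mul_of_nonneg_right h1 measureReal_nonneg) _
  · refine (min_le_right _ _).trans ?_
    calc a / 2 * (κ / 2) ^ scale γ β T ≤ a / 2 * (κ / 2) ^ scale γ β t :=
          mul_le_mul_of_nonneg_left (pow_le_pow_of_le_one (by positivity) (by linarith)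
            (scale_mono γ hβ0.le htT)) (by positivity)
      _ ≤ _ := by gcongr

theorem IsSolution.isBackwardIntegral {γ : StieltjesFunction ℝ} {b c : ℝ → ℝ} {m : Kernel ℝ ℝ}
    {t lam : ℝ} {w : ℝ → ℝ} (h : IsSolution γ b c m t lam w) :
    IsBackwardIntegral γ t lam (fun s => phi b c m s (w s)) w :=
  ⟨h.2.2.1, h.2.2.2⟩

/-- Bounds for the solutions that are uniform in the horizon and the terminal value. -/
theorem Admissible.exists_solution_bounds {γ : StieltjesFunction ℝ} {b c : ℝ → ℝ}
    {m : Kernel ℝ ℝ} (h : Admissible γ b c m) {T a a' : ℝ} (hT : 0 ≤ T) (ha : 0 < a)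
    (haa : a ≤ a') :
    ∃ ε M : ℝ, 0 < ε ∧ ε ≤ 1 ∧ 1 ≤ M ∧ ∀ t lam : ℝ, 0 ≤ t → t ≤ T → a ≤ lam → lam ≤ a' →
      ∀ w : ℝ → ℝ, IsSolution γ b c m t lam w → ∀ r ∈ Icc 0 t, w r ∈ Icc ε M := by
  obtain ⟨ε, M, hε, hε1, hM, H⟩ := h.exists_bounds hT ha haa
  refine ⟨ε, M, hε, hε1, hM, fun t lam ht htT hla hla' w hw => ?_⟩
  exact H t lam ht htT hla hla' w w hw.isBackwardIntegral fun s hs =>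
    ⟨hw.1 s ⟨hs.1.le, hs.2⟩, le_max_left _ _, fun _ _ => rfl⟩

theorem Admissible.exists_isSolution {γ : StieltjesFunction ℝ} {b c : ℝ → ℝ} {m : Kernel ℝ ℝ}
    (h : Admissible γ b c m) {t lam : ℝ} (ht : 0 ≤ t) (hlam : 0 < lam) :
    ∃ w, IsSolution γ b c m t lam w := by
  obtain ⟨ε, M, hε, hε1, hM1, H⟩ := h.exists_bounds ht hlam le_rfl
  have hεM : ε ≤ M := hε1.trans hM1
  obtain ⟨L, hL, hLip⟩ := h.exists_phi_lipschitz hε hεM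
  obtain ⟨C, hC0, hC⟩ := h.exists_abs_phi_le (hε.le.trans hεM)
  set tr : ℝ → ℝ := fun x => max ε (min x M) with htr
  have htr_mem : ∀ x, tr x ∈ Icc ε M := fun x =>
    ⟨le_max_left _ _, max_le hεM (min_le_right _ _)⟩
  have htr_lip : ∀ x y, |tr x - tr y| ≤ |x - y| := fun x y =>
    (abs_max_sub_max_le_max ε _ ε _).trans (by
      rw [sub_self, abs_zero, max_eq_right (abs_nonneg _)]
      exact (abs_min_sub_min_le_max x M y M).trans (by simp))
  set F : ℝ → ℝ → ℝ := fun s x => if 0 < s then phi b c m s (tr x) else 0 with hF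
  have hFLip : ∀ s x y, |F s x - F s y| ≤ L * |x - y| := by
    intro s x y
    by_cases hs : 0 < s
    · simp only [hF, if_pos hs]
      exact (hLip s hs.le _ (htr_mem x) _ (htr_mem y)).trans
        (mul_le_mul_of_nonneg_left (htr_lip x y) hL.le)
    · simp only [hF, if_neg hs, sub_self, abs_zero]
      positivity
  have hFC : ∀ s x, |F s x| ≤ C := by
    intro s x
    by_cases hs : 0 < s
    · simp only [hF, if_pos hs]
      exact hC s _ hs.le (hε.le.trans (htr_mem x).1) (htr_mem x).2
    · simp only [hF, if_neg hs, abs_zero]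
      exact hC0.le
  -- `F` is continuous in its second argument and measurable in its first.
  have hFm : Measurable (Function.uncurry F) := by
    have h1 : Measurable (Function.uncurry fun x s => F s x) := by
      refine measurable_uncurry_of_continuous_of_measurable (fun s => ?_) fun x => ?_
      · refine (LipschitzWith.of_dist_le_mul (K := ⟨L, hL.le⟩) fun x y => ?_).continuous
        rw [Real.dist_eq, Real.dist_eq]
        exact hFLip s x y
      · exact Measurable.ite measurableSet_Ioi (h.measurable_phi _) measurable_const
    exact h1.comp measurable_swap
  obtain ⟨w, hwm, hw⟩ := exists_picard γ hL hFm hFC hFLip t lam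
  have hFphi : ∀ r, 0 ≤ r → ∀ s ∈ Ioc r t, F s (w s) = phi b c m s (tr (w s)) :=
    fun r hr s hs => if_pos (hr.trans_lt hs.1)
  have hint : IntegrableOn (fun s => F s (w s)) (Ioc 0 t) γ.measure :=
    integrableOn_of_bounded γ (hFm.comp (measurable_id.prodMk hwm)).aestronglyMeasurable
      fun s _ => hFC s _
  have hback : IsBackwardIntegral γ t lam (fun s => phi b c m s (tr (w s))) w := by
    refine ⟨hint.congr_fun (hFphi 0 le_rfl) measurableSet_Ioc, fun r hr => ?_⟩
    rw [hw r hr.2, setIntegral_congr_fun measurableSet_Ioc (hFphi r hr.1)]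
  have htr_eq : ∀ x, ε ≤ x → x ≤ M → tr x = x := fun x h1 h2 => by
    simp only [htr]; rw [min_eq_left h2, max_eq_right h1]
  have hb := H t lam ht le_rfl le_rfl le_rfl _ w hback fun s _ =>
    ⟨hε.trans_le (htr_mem _).1, max_le (le_max_right _ _) ((min_le_left _ _).trans
      (le_max_left _ _)), htr_eq _⟩
  have hphi : ∀ r, 0 ≤ r → ∀ s ∈ Ioc r t, phi b c m s (tr (w s)) = phi b c m s (w s) := by
    intro r hr s hs
    have := hb s ⟨(hr.trans_lt hs.1).le, hs.2⟩
    rw [htr_eq _ this.1 this.2]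
  refine ⟨w, fun r hr => hε.trans_le (hb r hr).1, ⟨M, fun r hr => (hb r hr).2⟩,
    hback.integrableOn.congr_fun (hphi 0 le_rfl) measurableSet_Ioc, fun r hr => ?_⟩
  rw [hback.eq r hr, setIntegral_congr_fun measurableSet_Ioc (hphi r hr.1)]

theorem Admissible.eqOn_of_isSolution {γ : StieltjesFunction ℝ} {b c : ℝ → ℝ} {m : Kernel ℝ ℝ}
    (h : Admissible γ b c m) {t lam : ℝ} (ht : 0 ≤ t) (hlam : 0 < lam) {w w' : ℝ → ℝ}
    (hw : IsSolution γ b c m t lam w) (hw' : IsSolution γ b c m t lam w') :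
    EqOn w w' (Icc 0 t) := by
  obtain ⟨ε, M, hε, hε1, hM1, H⟩ := h.exists_solution_bounds ht hlam le_rfl
  obtain ⟨L, hL, hLip⟩ := h.exists_phi_lipschitz hε (hε1.trans hM1)
  have hb := H t lam ht le_rfl le_rfl le_rfl w hw
  have hb' := H t lam ht le_rfl le_rfl le_rfl w' hw'
  have hi := hw.isBackwardIntegral
  have hi' := hw'.isBackwardIntegral
  have hm : AEStronglyMeasurable (fun s => |w s - w' s|) (γ.measure.restrict (Ioc 0 t)) := by
    exact (hi.aestronglyMeasurable.sub hi'.aestronglyMeasurable).norm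
  have hbd : ∀ r ∈ Icc 0 t, |(|w r - w' r|)| ≤ M := by
    intro r hr
    have h1 := hb r hr
    have h2 := hb' r hr
    rw [abs_abs, abs_le]
    constructor <;> linarith [h1.1, h1.2, h2.1, h2.2]
  intro r hr
  have hg := gronwall γ (y := fun s => |w s - w' s|) (A := 0) hL le_rfl hm hbd ?_ r hr
  · rw [mul_zero, zero_mul] at hg
    exact sub_eq_zero.1 (abs_nonpos_iff.1 hg)
  · intro r hr
    have hyi : IntegrableOn (fun s => |w s - w' s|) (Ioc r t) γ.measure :=
      integrableOn_of_bounded γ (hm.mono_measure (Measure.restrict_mono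
        (Ioc_subset_Ioc_left hr.1) le_rfl)) fun s hs => hbd s ⟨hr.1.trans hs.1.le, hs.2⟩
    have h1 := hi.integrableOn_Ioc hr.1 le_rfl
    have h2 := hi'.integrableOn_Ioc hr.1 le_rfl
    have e : w r - w' r =
        -∫ s in Ioc r t, (phi b c m s (w s) - phi b c m s (w' s)) ∂γ.measure := by
      rw [integral_sub h1 h2, hi.eq r hr, hi'.eq r hr]; ring
    rw [zero_add, e, abs_neg, ← integral_const_mul]
    refine abs_integral_le_integral_abs.trans ?_
    refine setIntegral_mono_on (h1.sub h2).abs (hyi.const_mul L) measurableSet_Ioc fun s hs => ?_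
    have hs' : s ∈ Icc 0 t := ⟨hr.1.trans hs.1.le, hs.2⟩
    exact hLip s hs'.1 _ (hb s hs') _ (hb' s hs')

/-! ### Comparison of the discrete semigroup with the solution -/

theorem pgfIter_add (p : ℕ → PMF ℕ) (m l l' : ℕ) (z : ℝ) :
    pgfIter p m (l + l') z = pgfIter p m l (pgfIter p (m + l) l' z) := by
  induction l generalizing m with
  | zero => simp [pgfIter]
  | succ l ih =>
    rw [show l + 1 + l' = (l + l') + 1 by ring, pgfIter, pgfIter, ih,
      show m + 1 + l = m + (l + 1) by ring]

theorem pgfComp_trans (p : ℕ → PMF ℕ) {m n l : ℕ} (h : m ≤ n) (h' : n ≤ l) (z : ℝ) :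
    pgfComp p m l z = pgfComp p m n (pgfComp p n l z) := by
  unfold pgfComp
  rw [show l - m = (n - m) + (l - n) by omega, pgfIter_add, show m + (n - m) = n by omega]

theorem pgfComp_of_lt (p : ℕ → PMF ℕ) {m n : ℕ} (h : m < n) (z : ℝ) :
    pgfComp p m n z = pgf (p m) (pgfComp p (m + 1) n z) := by
  unfold pgfComp
  rw [show n - m = (n - (m + 1)) + 1 by omega, pgfIter]

theorem pgfComp_self (p : ℕ → PMF ℕ) (m : ℕ) (z : ℝ) : pgfComp p m m z = z := by
  simp [pgfComp, pgfIter]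

/-- Condition (A) bounds the error at a single jump by the increment of `F_k`. -/
theorem abs_I1_add_abs_I2_le {γ : StieltjesFunction ℝ} {b c : ℝ → ℝ} {m : Kernel ℝ ℝ}
    {β : ℕ → ℝ} {p : ℕ → ℕ → PMF ℕ} {M : ℝ} (hM : 0 < M) {F : ℕ → StieltjesFunction ℝ}
    (hF : ∀ T : ℝ, 0 ≤ T → ∀ lam : ℕ → ℝ → ℝ,
      (∀ k : ℕ, 1 ≤ k → ∀ s ∈ Icc 0 T, lam k s ∈ Icc 0 (min M (k : ℝ))) →
      ∀ k : ℕ, 1 ≤ k → ∀ r t : ℝ, 0 ≤ r → r ≤ t → t ≤ T →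
        ∑ᶠ s ∈ jumpSet γ (β k) r t,
          (|I1 γ b c m (β k) (p k) k s (lam k s)| + |I2 γ b c m (β k) (p k) k s (lam k s)|)
          ≤ F k t - F k r)
    {k : ℕ} (hk : 1 ≤ k) (hβ : 0 ≤ β k) {r s x : ℝ} (hr : 0 ≤ r) (hs : s ∈ jumpSet γ (β k) r s)
    (hx : x ∈ Icc 0 (min M (k : ℝ))) :
    |I1 γ b c m (β k) (p k) k s x| + |I2 γ b c m (β k) (p k) k s x| ≤ F k s - F k r := by
  have hrs : r < s := hs.1.1
  have h := hF s (hr.trans hrs.le) (fun k' _ => if k' = k then x else 0) (fun k' _ s' _ => by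
    split_ifs with e
    · rw [e]; exact hx
    · exact ⟨le_rfl, le_min hM.le (Nat.cast_nonneg _)⟩) k hk r s hr hrs.le le_rfl
  simp only [if_true] at h
  refine le_trans ?_ h
  have hfin := jumpSet_finite γ hβ r s
  rw [finsum_mem_eq_finite_toFinset_sum _ hfin]
  exact Finset.single_le_sum
    (f := fun s => |I1 γ b c m (β k) (p k) k s x| + |I2 γ b c m (β k) (p k) k s x|)
    (fun i _ => by positivity) (hfin.mem_toFinset.2 hs)

/-- One step of the discrete Gronwall recursion: a jump of mass `δ` preceded by a stretch of
mass `μ`. -/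
theorem gronwall_step {L μ δ κ D g e Q : ℝ} (hL : 0 ≤ L) (hμ : 0 ≤ μ) (hδ : 0 ≤ δ) (hκ : 0 ≤ κ)
    (hg : 0 ≤ g) (he : 0 ≤ e) (hQ : 0 ≤ Q) (hD : D ≤ Real.exp (L * e) * Q) :
    (1 + L * μ) * ((1 + L * δ) * D + g) + L * μ * κ + g ≤
      Real.exp (L * (e + (μ + δ))) * (Q + 2 * g + L * κ * (μ + δ)) := by
  have h1 : 1 + L * μ ≤ Real.exp (L * μ) := by linarith [Real.add_one_le_exp (L * μ)]
  have h2 : 1 + L * δ ≤ Real.exp (L * δ) := by linarith [Real.add_one_le_exp (L * δ)]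
  have hLμ : 0 ≤ L * μ := by positivity
  have hLδ : 0 ≤ L * δ := by positivity
  set P := (1 + L * μ) * (1 + L * δ) with hP
  have hP1 : 1 + L * μ ≤ P := by rw [hP]; nlinarith
  have hPE : P ≤ Real.exp (L * (μ + δ)) := by
    rw [mul_add, Real.exp_add]
    exact mul_le_mul h1 h2 (by positivity) (Real.exp_pos _).le
  set E := Real.exp (L * (μ + δ)) with hE
  set E' := Real.exp (L * e) with hE'
  have hE'1 : 1 ≤ E' := Real.one_le_exp (by positivity)
  have hE1 : 1 ≤ E := Real.one_le_exp (by positivity)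
  have hexp : Real.exp (L * (e + (μ + δ))) = E' * E := by rw [mul_add, Real.exp_add]
  rw [hexp]
  have hEE : E ≤ E' * E := by nlinarith
  have hg2 : (1 + L * μ) * g + g ≤ E' * E * (2 * g) := by
    have : (1 + L * μ) * g ≤ E' * E * g :=
      mul_le_mul_of_nonneg_right ((hP1.trans hPE).trans hEE) hg
    have : g ≤ E' * E * g := by nlinarith
    linarith
  have hκ2 : L * μ * κ ≤ E' * E * (L * κ * (μ + δ)) := by
    have h3 : L * μ * κ ≤ L * κ * (μ + δ) := by nlinarith [mul_nonneg hLδ hκ]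
    have h4 : 0 ≤ L * κ * (μ + δ) := by positivity
    nlinarith
  have hP0 : 0 ≤ P := by positivity
  have hD2 : P * D ≤ E' * E * Q := by
    calc P * D ≤ P * (E' * Q) := mul_le_mul_of_nonneg_left hD hP0
      _ ≤ E * (E' * Q) := mul_le_mul_of_nonneg_right hPE (by positivity)
      _ = _ := by ring
  calc _ = P * D + ((1 + L * μ) * g + g) + L * μ * κ := by rw [hP]; ring
    _ ≤ E' * E * Q + E' * E * (2 * g) + E' * E * (L * κ * (μ + δ)) := by linarith
    _ = _ := by ring

set_option maxHeartbeats 800000 in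
/-- If the errors at the jumps are dominated by the increments of `G`, then the discrete
cumulants `u = k (1 - g_{k,γ_k(r),γ_k(t)})` stay close to the solution `w`. The recursion runs
backwards over the jumps of `γ_k`; because the accumulated distance stays below `ε / 2`, the
cumulants never leave `[ε / 2, 2M]`, where `φ(s, ·)` is Lipschitz. -/
theorem abs_cumulant_sub_le {γ : StieltjesFunction ℝ} {b c : ℝ → ℝ} {m : Kernel ℝ ℝ}
    (h : Admissible γ b c m) {β : ℝ} (hβ : 0 < β) {p : ℕ → PMF ℕ} {k : ℕ} (hk : 1 ≤ k)
    {t lam z ε M L C e₁ η : ℝ} {w : ℝ → ℝ} {G : StieltjesFunction ℝ} (hε : 0 < ε) (hεM : ε ≤ M)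
    (hkM : 2 * M ≤ k) (hw : IsBackwardIntegral γ t lam (fun s => phi b c m s (w s)) w)
    (hwb : ∀ r ∈ Icc 0 t, w r ∈ Icc ε M) (hL : 0 < L)
    (hLip : ∀ s, 0 ≤ s → ∀ x ∈ Icc (ε / 2) (2 * M), ∀ y ∈ Icc (ε / 2) (2 * M),
      |phi b c m s x - phi b c m s y| ≤ L * |x - y|)
    (hC0 : 0 < C) (hC : ∀ s x, 0 ≤ s → 0 ≤ x → x ≤ 2 * M → |phi b c m s x| ≤ C)
    (hG : ∀ s, 0 ≤ s → 0 ≤ G s)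
    (hI : ∀ r s x, 0 ≤ r → s ∈ jumpSet γ β r s → x ∈ Icc 0 (min (2 * M) (k : ℝ)) →
      |I1 γ b c m β p k s x| + |I2 γ b c m β p k s x| ≤ G s - G r)
    (hz : |k * (1 - z) - lam| ≤ e₁)
    (hη : Real.exp (L * γ t) * (e₁ + C / β + 2 * G t + L * (C / β) * γ t) ≤ η)
    (hsmall : (1 + L * γ t) * η + G t + C / β ≤ ε / 2) :
    ∀ r ∈ Icc 0 t,
      |k * (1 - pgfComp p (scale γ β r) (scale γ β t) z) -
        w (scaleInv γ β (scale γ β r))| ≤ η := by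
  have h0 := h.gamma_zero
  have hmono := scale_mono γ hβ.le
  have hk0 : (k : ℝ) ≠ 0 := by positivity
  have hCβ : 0 ≤ C / β := by positivity
  have he₁ : 0 ≤ e₁ := (abs_nonneg _).trans hz
  set Q : ℝ → ℝ := fun r =>
    e₁ + C / β + 2 * (G t - G r) + L * (C / β) * (γ t - γ r) with hQ
  have hQ0 : ∀ r, r ≤ t → 0 ≤ Q r := by
    intro r hr
    have := sub_nonneg.2 (G.mono hr)
    have := sub_nonneg.2 (γ.mono hr)
    simp only [hQ]
    positivity
  have hQη : ∀ r, 0 ≤ r → r ≤ t → Real.exp (L * (γ t - γ r)) * Q r ≤ η := by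
    intro r hr hrt
    refine le_trans ?_ hη
    have h1 := hG r hr
    have h2 := apply_nonneg h0 hr
    refine mul_le_mul (Real.exp_le_exp.2 (mul_le_mul_of_nonneg_left (by linarith) hL.le)) ?_
      (hQ0 r hrt) (Real.exp_pos _).le
    have h3 : L * (C / β) * (γ t - γ r) ≤ L * (C / β) * γ t :=
      mul_le_mul_of_nonneg_left (by linarith) (by positivity)
    simp only [hQ]
    linarith
  have hfC : ∀ s ∈ Ioc 0 t, |phi b c m s (w s)| ≤ C := fun s hs => by
    have := hwb s ⟨hs.1.le, hs.2⟩
    exact hC s _ hs.1.le (hε.le.trans this.1) (by linarith [this.2])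
  suffices H : ∀ n r, r ∈ Icc 0 t → scale γ β t - scale γ β r = n →
      |k * (1 - pgfComp p (scale γ β r) (scale γ β t) z) - w (scaleInv γ β (scale γ β r))| ≤
        Real.exp (L * (γ t - γ (scaleInv γ β (scale γ β r)))) *
          Q (scaleInv γ β (scale γ β r)) by
    intro r hr
    obtain ⟨g1, g2, -⟩ := scaleInv_scale h0 hβ hr.1
    exact (H _ r hr rfl).trans (hQη _ g1 (g2.trans hr.2))
  intro n
  induction n using Nat.strong_induction_on with
  | _ n ih =>
  intro r hr hn
  have ht : 0 ≤ t := hr.1.trans hr.2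
  obtain ⟨g1, g2, g3⟩ := scaleInv_scale h0 hβ hr.1
  set r₀ := scaleInv γ β (scale γ β r) with hr₀
  rcases (hmono hr.2).eq_or_lt with heq | hlt
  · rw [← heq, pgfComp_self]
    have h1 := hw.abs_sub_le hfC g1 (g2.trans hr.2) le_rfl
    rw [hw.apply_end ht, abs_sub_comm] at h1
    have h2 : C * (γ t - γ r₀) ≤ C / β := by
      have := sub_le_of_scale_eq h0 hβ g1 (heq.symm.trans g3.symm)
      rw [div_eq_mul_one_div]
      exact mul_le_mul_of_nonneg_left this hC0.le
    have h3 := abs_sub_le (k * (1 - z)) lam (w r₀)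
    have h4 := sub_nonneg.2 (G.mono (g2.trans hr.2))
    have h5 := sub_nonneg.2 (γ.mono (g2.trans hr.2))
    have h6 : e₁ + C / β ≤ Q r₀ := by
      have : 0 ≤ L * (C / β) * (γ t - γ r₀) := by positivity
      simp only [hQ]
      linarith
    have h7 : 1 ≤ Real.exp (L * (γ t - γ r₀)) := Real.one_le_exp (by positivity)
    nlinarith [hQ0 r₀ (g2.trans hr.2)]
  · obtain ⟨s, hrs, hst, hsc, hleft, hinv, hconst, hmass⟩ := exists_next_jump h0 hβ hr.1 ht hlt
    have hs0 : 0 < s := hr.1.trans_lt hrs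
    have hr₀s : r₀ < s := g2.trans_lt hrs
    have hle := hmono hst
    have hjump : s ∈ jumpSet γ β r₀ s := ⟨⟨hr₀s, le_rfl⟩, by omega⟩
    set δ := γ.measure.real {s} with hδ
    set μ := γ.measure.real (Ioo r₀ s) with hμ
    have hδ0 : 0 ≤ δ := measureReal_nonneg
    have hμ0 : 0 ≤ μ := measureReal_nonneg
    have hμδ : μ + δ = γ s - γ r₀ := measureReal_Ioo_add_atom γ hr₀s
    have hδt : δ ≤ γ t := by
      have := γ.mono hst
      have := apply_nonneg h0 g1
      linarith
    set g := G s - G r₀ with hg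
    have hg0 : 0 ≤ g := sub_nonneg.2 (G.mono hr₀s.le)
    have hgt : g ≤ G t := by
      have := G.mono hst
      have := hG r₀ g1
      linarith
    have hη0 : 0 ≤ η := (mul_nonneg (Real.exp_pos _).le (hQ0 r₀ (g2.trans hr.2))).trans
      (hQη r₀ g1 (g2.trans hr.2))
    have hγt := apply_nonneg h0 ht
    -- The cumulants after the jump, at the jump and before it.
    set X := k * (1 - pgfComp p (scale γ β s) (scale γ β t) z) with hX
    set W := k * (1 - pgfComp p (scale γ β r + 1) (scale γ β t) z) with hW
    set Y := k * (1 - pgfComp p (scale γ β r) (scale γ β t) z) with hY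
    have hX1 : 1 - X / k = pgfComp p (scale γ β s) (scale γ β t) z := by
      rw [hX]; field_simp; ring
    have hW1 : 1 - W / k = pgfComp p (scale γ β r + 1) (scale γ β t) z := by
      rw [hW]; field_simp; ring
    have hWX : W = X - phi b c m s X * δ - I2 γ b c m β p k s X := by
      unfold I2
      rw [hleft, hX1, ← pgfComp_trans p (Nat.succ_le_of_lt hsc) hle]
      rw [hW, hX]; ring
    have hYW : Y = W - ∫ u in Ioo r₀ s, phi b c m u W ∂γ.measure - I1 γ b c m β p k s W := by
      unfold I1
      rw [hleft, hW1, ← pgfComp_of_lt p hlt]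
      rw [hW, hY]; ring
    have hD := ih (scale γ β t - scale γ β s) (by omega) s ⟨hs0.le, hst⟩ rfl
    rw [hinv] at hD
    set D := |X - w s| with hDdef
    have hDη : D ≤ η := hD.trans (hQη s hs0.le hst)
    have hws := hwb s ⟨hs0.le, hst⟩
    have hη2 : η ≤ ε / 2 := by
      have := hG t ht
      nlinarith [mul_nonneg (mul_nonneg hL.le hγt) hη0]
    have hXm : X ∈ Icc (ε / 2) (2 * M) := by
      have := abs_le.1 (hDη.trans hη2)
      constructor <;> linarith [this.1, this.2, hws.1, hws.2]
    have hmemk : ∀ x ∈ Icc (ε / 2) (2 * M), x ∈ Icc 0 (min (2 * M) (k : ℝ)) := fun x hx =>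
      ⟨by linarith [hx.1], le_min hx.2 (hx.2.trans hkM)⟩
    have hwm : ∀ r ∈ Icc 0 t, w r ∈ Icc (ε / 2) (2 * M) := fun r hr =>
      ⟨by linarith [(hwb r hr).1], by linarith [(hwb r hr).2]⟩
    -- The left limit of `w` at `s`.
    set V := w s - phi b c m s (w s) * δ with hV
    have hI2 : |I2 γ b c m β p k s X| ≤ g := by
      have := hI r₀ s X g1 hjump (hmemk X hXm)
      linarith [abs_nonneg (I1 γ b c m β p k s X)]
    have hWV : |W - V| ≤ (1 + L * δ) * D + g := by
      have e : W - V = (X - w s) - (phi b c m s X - phi b c m s (w s)) * δ -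
          I2 γ b c m β p k s X := by rw [hWX, hV]; ring
      have h1 : |(phi b c m s X - phi b c m s (w s)) * δ| ≤ L * D * δ := by
        rw [abs_mul, abs_of_nonneg hδ0]
        exact mul_le_mul_of_nonneg_right
          (hLip s hs0.le X hXm _ (hwm s ⟨hs0.le, hst⟩)) hδ0
      rw [e]
      have h2 := abs_sub ((X - w s) - (phi b c m s X - phi b c m s (w s)) * δ)
        (I2 γ b c m β p k s X)
      have h3 := abs_sub (X - w s) ((phi b c m s X - phi b c m s (w s)) * δ)
      linarith
    have hVw : ∀ u, r₀ ≤ u → u < s → |V - w u| ≤ C / β := by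
      intro u hu hus
      have hfin : γ.measure (Ioo r₀ s) ≠ ⊤ :=
        ((measure_mono Ioo_subset_Ioc_self).trans_lt (measure_Ioc_ne_top γ r₀ s).lt_top).ne
      rw [hw.eq_sub_atom (g1.trans hu) hus hst, sub_sub_cancel]
      have h1 : ‖∫ x in Ioo u s, phi b c m x (w x) ∂γ.measure‖ ≤
          C * γ.measure.real (Ioo u s) :=
        norm_setIntegral_le_of_norm_le_const
          ((measure_mono (Ioo_subset_Ioo_left hu)).trans_lt hfin.lt_top)
          fun x hx => hfC x ⟨(g1.trans hu).trans_lt hx.1, hx.2.le.trans hst⟩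
      refine h1.trans ?_
      rw [div_eq_mul_one_div]
      exact mul_le_mul_of_nonneg_left
        ((measureReal_mono (Ioo_subset_Ioo_left hu) hfin).trans hmass) hC0.le
    have hWm : W ∈ Icc (ε / 2) (2 * M) := by
      have h1 := hwb r₀ ⟨g1, g2.trans hr.2⟩
      have h2 := abs_sub_le W V (w r₀)
      have h3 := hVw r₀ le_rfl hr₀s
      have h4 : (1 + L * δ) * D ≤ (1 + L * γ t) * η := by gcongr
      have := abs_le.1 (show |W - w r₀| ≤ ε / 2 by linarith)
      constructor <;> linarith [this.1, this.2, h1.1, h1.2]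
    have hI1 : |I1 γ b c m β p k s W| ≤ g := by
      have := hI r₀ s W g1 hjump (hmemk W hWm)
      linarith [abs_nonneg (I2 γ b c m β p k s W)]
    have hint1 : IntegrableOn (fun u => phi b c m u W) (Ioo r₀ s) γ.measure :=
      (integrableOn_of_bounded γ (h.measurable_phi W).aestronglyMeasurable fun u hu =>
        hC u W (g1.trans hu.1.le) (by linarith [hWm.1]) hWm.2).mono_set Ioo_subset_Ioc_self
    have hint2 : IntegrableOn (fun u => phi b c m u (w u)) (Ioo r₀ s) γ.measure :=
      (hw.integrableOn_Ioc g1 hst).mono_set Ioo_subset_Ioc_self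
    have hYw : |Y - w r₀| ≤ |W - V| + L * (|W - V| + C / β) * μ + g := by
      have e : Y - w r₀ = (W - V) -
          ∫ u in Ioo r₀ s, (phi b c m u W - phi b c m u (w u)) ∂γ.measure -
          I1 γ b c m β p k s W := by
        rw [integral_sub hint1 hint2, hYW, hw.eq_sub_atom g1 hr₀s hst]; ring
      have h1 : ‖∫ u in Ioo r₀ s, (phi b c m u W - phi b c m u (w u)) ∂γ.measure‖ ≤
          L * (|W - V| + C / β) * μ := by
        refine norm_setIntegral_le_of_norm_le_const
          ((measure_mono Ioo_subset_Ioc_self).trans_lt (measure_Ioc_ne_top γ r₀ s).lt_top)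
          fun u hu => ?_
        have hu0 := g1.trans hu.1.le
        refine (hLip u hu0 W hWm _ (hwm u ⟨hu0, hu.2.le.trans hst⟩)).trans ?_
        refine mul_le_mul_of_nonneg_left ?_ hL.le
        exact (abs_sub_le W V (w u)).trans (by linarith [hVw u hu.1.le hu.2])
      rw [Real.norm_eq_abs] at h1
      rw [e]
      have h2 := abs_sub ((W - V) - ∫ u in Ioo r₀ s, (phi b c m u W - phi b c m u (w u)) ∂γ.measure)
        (I1 γ b c m β p k s W)
      have h3 := abs_sub (W - V) (∫ u in Ioo r₀ s, (phi b c m u W - phi b c m u (w u)) ∂γ.measure)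
      linarith
    have hfinal := gronwall_step (L := L) (μ := μ) (δ := δ) (κ := C / β) (D := D) (g := g)
      (e := γ t - γ s) (Q := Q s) hL.le hμ0 hδ0 hCβ hg0 (sub_nonneg.2 (γ.mono hst)) (hQ0 s hst) hD
    have e1 : γ t - γ s + (μ + δ) = γ t - γ r₀ := by rw [hμδ]; ring
    have e2 : Q s + 2 * g + L * (C / β) * (μ + δ) = Q r₀ := by
      rw [hμδ]; simp only [hQ, hg]; ring
    rw [e1, e2] at hfinal
    refine le_trans (hYw.trans ?_) hfinal
    have h5 : (1 + L * μ) * |W - V| ≤ (1 + L * μ) * ((1 + L * δ) * D + g) :=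
      mul_le_mul_of_nonneg_left hWV (by positivity)
    linarith

theorem abs_neg_mul_log_sub_le {k U M : ℝ} (hU : 0 ≤ U) (hUM : U ≤ M) (hk : 0 < k)
    (hkM : 2 * M ≤ k) : |-k * Real.log (1 - U / k) - U| ≤ 2 * M ^ 2 / k := by
  set x := U / k with hx
  have hx0 : 0 ≤ x := div_nonneg hU hk.le
  have hx1 : x ≤ 1 / 2 := by rw [hx, div_le_iff₀ hk]; linarith
  have hUk : U = k * x := by rw [hx]; field_simp
  have hpos : 0 < 1 - x := by linarith
  have h1 := Real.log_le_sub_one_of_pos hpos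
  have h2 := Real.log_le_sub_one_of_pos (inv_pos.2 hpos)
  rw [Real.log_inv] at h2
  have h3 : (1 - x)⁻¹ - 1 ≤ x + 2 * x ^ 2 := by
    rw [sub_le_iff_le_add, inv_le_iff_one_le_mul₀ hpos]
    nlinarith [mul_nonneg hx0 hx0]
  have h4 : k * (2 * x ^ 2) ≤ 2 * M ^ 2 / k := by
    rw [le_div_iff₀ hk]
    have : k * (2 * x ^ 2) * k = 2 * U ^ 2 := by rw [hUk]; ring
    rw [this]
    gcongr
  have h5 : |-k * Real.log (1 - x) - U| = k * (-Real.log (1 - x) - x) := by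
    rw [hUk, ← abs_of_nonneg (a := k * (-Real.log (1 - x) - x))
      (mul_nonneg hk.le (by linarith))]
    congr 1; ring
  rw [h5]
  refine (mul_le_mul_of_nonneg_left ?_ hk.le).trans h4
  linarith

theorem abs_mul_one_sub_exp_sub_le {k lam : ℝ} (hk : 0 < k) (hlam : 0 ≤ lam) :
    |k * (1 - Real.exp (-lam / k)) - lam| ≤ lam ^ 2 / k := by
  have hu : 0 ≤ lam / k := div_nonneg hlam hk.le
  have h1 := exp_neg_sub_one_add_nonneg (lam / k)
  have h2 := exp_neg_sub_one_add_le_sq hu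
  have e : k * (1 - Real.exp (-lam / k)) - lam =
      -(k * (Real.exp (-(lam / k)) - 1 + lam / k)) := by
    rw [neg_div]; field_simp; ring
  rw [e, abs_neg, abs_of_nonneg (mul_nonneg hk.le h1)]
  calc k * (Real.exp (-(lam / k)) - 1 + lam / k) ≤ k * (lam / k) ^ 2 :=
        mul_le_mul_of_nonneg_left h2 hk.le
    _ = _ := by field_simp

set_option maxHeartbeats 400000 in
/-- Uniform convergence of the discrete cumulants to any family of solutions. -/
theorem tendstoUniformlyOn_vk {γ : StieltjesFunction ℝ} {b c : ℝ → ℝ} {m : Kernel ℝ ℝ}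
    (h : Admissible γ b c m) {β : ℕ → ℝ} (hβpos : ∀ k, 1 ≤ k → 0 < β k)
    (hβlim : Tendsto β atTop atTop) {p : ℕ → ℕ → PMF ℕ} (hA : ConditionA γ b c m β p)
    {v : ℝ → ℝ → ℝ → ℝ}
    (hv : ∀ t lam : ℝ, 0 ≤ t → 0 < lam → IsSolution γ b c m t lam fun r => v r t lam)
    {T a a' : ℝ} (hT : 0 ≤ T) (ha : 0 < a) (haa : a ≤ a') :
    TendstoUniformlyOn (fun (k : ℕ) (x : ℝ × ℝ × ℝ) => vk γ β p k x.1 x.2.1 x.2.2)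
      (fun x : ℝ × ℝ × ℝ => v x.1 x.2.1 x.2.2) atTop
      {x | 0 ≤ x.1 ∧ x.1 ≤ x.2.1 ∧ x.2.1 ≤ T ∧ a ≤ x.2.2 ∧ x.2.2 ≤ a'} := by
  have h0 := h.gamma_zero
  obtain ⟨ε, M, hε, hε1, hM1, hbounds⟩ := h.exists_solution_bounds hT ha haa
  have hM0 : 0 < M := by linarith
  have hεM : ε ≤ M := hε1.trans hM1
  obtain ⟨L, hL, hLip⟩ := h.exists_phi_lipschitz (ε := ε / 2) (M := 2 * M) (by positivity)
    (by linarith)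
  obtain ⟨C, hC0, hC⟩ := h.exists_abs_phi_le (M := 2 * M) (by positivity)
  obtain ⟨F, hF0, hFlim, hF⟩ := hA (2 * M) (by positivity)
  have hΓ : 0 ≤ γ T := apply_nonneg h0 hT
  set η : ℕ → ℝ := fun k => Real.exp (L * γ T) *
    (a' ^ 2 / k + C / β k + 2 * F k T + L * (C / β k) * γ T) with hη
  have hklim : ∀ A : ℝ, Tendsto (fun k : ℕ => A / (k : ℝ)) atTop (𝓝 0) :=
    fun A => tendsto_natCast_atTop_atTop.const_div_atTop A
  have hβlim' : Tendsto (fun k => C / β k) atTop (𝓝 0) := hβlim.const_div_atTop C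
  have hηlim : Tendsto η atTop (𝓝 0) := by
    have := (((hklim (a' ^ 2)).add hβlim').add ((hFlim T hT).const_mul 2)).add
      ((hβlim'.const_mul L).mul_const (γ T)) |>.const_mul (Real.exp (L * γ T))
    simpa using this
  have hsmall_lim : Tendsto (fun k => (1 + L * γ T) * η k + F k T + C / β k) atTop (𝓝 0) := by
    simpa using ((hηlim.const_mul (1 + L * γ T)).add (hFlim T hT)).add hβlim'
  have hrate_lim : Tendsto (fun k : ℕ => 2 * (2 * M) ^ 2 / (k : ℝ) + η k + C / β k) atTop
      (𝓝 0) := by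
    simpa using ((hklim (2 * (2 * M) ^ 2)).add hηlim).add hβlim'
  rw [Metric.tendstoUniformlyOn_iff]
  intro e he
  filter_upwards [hsmall_lim.eventually_lt_const (show 0 < ε / 2 by positivity),
    hrate_lim.eventually_lt_const he, eventually_ge_atTop 1,
    tendsto_natCast_atTop_atTop.eventually_ge_atTop (2 * (2 * M))] with k hsmall hrate hk1 hkM
  rintro ⟨r, t, lam⟩ ⟨hr, hrt, htT, hla, hla'⟩
  simp only at hr hrt htT hla hla'
  have ht : 0 ≤ t := hr.trans hrt
  have hlam : 0 < lam := ha.trans_le hla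
  have hk0 : (0 : ℝ) < k := by positivity
  have hβk := hβpos k hk1
  have hsol := hv t lam ht hlam
  have hw := hsol.isBackwardIntegral
  have hwb := hbounds t lam ht htT hla hla' _ hsol
  have hγt := apply_nonneg h0 ht
  have hγtT := γ.mono htT
  have hFt := hF0 k hk1 t ht
  have hFtT := (F k).mono htT
  have hηt : Real.exp (L * γ t) *
      (a' ^ 2 / k + C / β k + 2 * F k t + L * (C / β k) * γ t) ≤ η k := by
    simp only [hη]
    gcongr
  have hη0 : 0 ≤ η k := le_trans (by positivity) hηt
  have hz : |k * (1 - Real.exp (-lam / k)) - lam| ≤ a' ^ 2 / k :=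
    (abs_mul_one_sub_exp_sub_le hk0 hlam.le).trans (by gcongr)
  have hclose := abs_cumulant_sub_le h hβk (p := p k) hk1 (G := F k) hε hεM
    (by linarith) hw hwb hL hLip hC0 hC (hF0 k hk1)
    (fun r s x hr hs hx => abs_I1_add_abs_I2_le (by positivity) hF hk1 hβk.le hr hs hx) hz hηt
    (by
      have : (1 + L * γ t) * η k ≤ (1 + L * γ T) * η k := by gcongr
      linarith) r ⟨hr, hrt⟩
  set U := (k : ℝ) * (1 - pgfComp (p k) (scale γ (β k) r) (scale γ (β k) t)
    (Real.exp (-lam / k))) with hU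
  obtain ⟨g1, g2, g3⟩ := scaleInv_scale h0 hβk hr
  set r₀ := scaleInv γ (β k) (scale γ (β k) r) with hr₀
  have hvr : |v r₀ t lam - v r t lam| ≤ C / β k := by
    have h1 := hw.abs_sub_le (C := C) (fun s hs => ?_) g1 g2 hrt
    · refine h1.trans ?_
      rw [div_eq_mul_one_div]
      exact mul_le_mul_of_nonneg_left (sub_le_of_scale_eq h0 hβk g1 g3.symm) hC0.le
    · have := hwb s ⟨hs.1.le, hs.2⟩
      exact hC s _ hs.1.le (hε.le.trans this.1) (by linarith [this.2])
  have hUm : U ∈ Icc 0 (2 * M) := by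
    have h1 := hwb r₀ ⟨g1, g2.trans hrt⟩
    have h2 : η k ≤ ε / 2 := by
      have : 0 ≤ C / β k := by positivity
      nlinarith [mul_nonneg (mul_nonneg hL.le hΓ) hη0]
    have h3 := abs_le.1 hclose
    constructor <;> linarith [h1.1, h1.2, h3.1, h3.2]
  have hvk : vk γ β p k r t lam = -(k : ℝ) * Real.log (1 - U / k) := by
    unfold vk
    congr 2
    rw [hU]; field_simp; ring
  have hlog := abs_neg_mul_log_sub_le hUm.1 hUm.2 hk0 hkM
  rw [dist_comm, Real.dist_eq]
  simp only
  rw [hvk]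
  have h1 := abs_sub_le (-(k : ℝ) * Real.log (1 - U / k)) U (v r t lam)
  have h2 := abs_sub_le U (v r₀ t lam) (v r t lam)
  linarith

end GWVE

theorem mainTheorem2 (γ : StieltjesFunction ℝ) (b c : ℝ → ℝ)
    (m : ProbabilityTheory.Kernel ℝ ℝ) (hadm : GWVE.Admissible γ b c m)
    (β : ℕ → ℝ) (hβpos : ∀ k, 1 ≤ k → 0 < β k) (hβmono : MonotoneOn β (Set.Ici 1))
    (hβlim : Filter.Tendsto β Filter.atTop Filter.atTop)
    (p : ℕ → ℕ → PMF ℕ) (hA : GWVE.ConditionA γ b c m β p) :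
    ∃ v : ℝ → ℝ → ℝ → ℝ,
      (∀ t lam : ℝ, 0 ≤ t → 0 < lam →
        GWVE.IsSolution γ b c m t lam (fun r => v r t lam) ∧
        ∀ w : ℝ → ℝ, GWVE.IsSolution γ b c m t lam w →
          Set.EqOn w (fun r => v r t lam) (Set.Icc 0 t)) ∧
      ∀ T a b' : ℝ, 0 ≤ T → 0 < a → a < b' →
        TendstoUniformlyOn
          (fun (k : ℕ) (x : ℝ × ℝ × ℝ) => GWVE.vk γ β p k x.1 x.2.1 x.2.2)
          (fun x : ℝ × ℝ × ℝ => v x.1 x.2.1 x.2.2)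
          Filter.atTop
          {x | 0 ≤ x.1 ∧ x.1 ≤ x.2.1 ∧ x.2.1 ≤ T ∧ a ≤ x.2.2 ∧ x.2.2 ≤ b'} := by
  choose! w hw using fun t lam (ht : 0 ≤ t) (hlam : 0 < lam) => hadm.exists_isSolution ht hlam
  refine ⟨fun r t lam => w t lam r, fun t lam ht hlam => ⟨hw t lam ht hlam, fun w' hw' => ?_⟩,
    fun T a b' hT ha hab => ?_⟩
  · exact hadm.eqOn_of_isSolution ht hlam hw' (hw t lam ht hlam)
  · exact GWVE.tendstoUniformlyOn_vk hadm hβpos hβlim hA hw hT ha hab.le
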